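/- Let $M_0, M_1 > 1$, $M_2 > 0$ and $0 < \eta < 1$. There is a finite constant $C_1 > 0$, depending only on $M_0, M_1, M_2, \eta$, such that the following holds for every positive integer $n$ and all positive weights $(w_x^+)_{x\in[n]}$, $(w_x^-)_{x\in[n]}$, $[n]=\{1,\dots,n\}$, with $$\sum_{x\in[n]} w_x^+ = \sum_{x\in[n]} w_x^-, \qquad M_0 \le w_x^+ \le M_1 \ \text{ for all } x\in[n], \qquad \sum_{x\in[n]} (w_x^-)^{2+\eta} \le M_2\, n .$$ Let $G$ be the Chung–Lu digraph on $[n]$: it has no loops, and for distinct $x,y\in[n]$ the oriented edge $x\to y$ is present, independently of all others, with probability $p_{xy} = \min\{w_x^+ w_y^- \frac{\log n}{n},\, 1\}$. Let $\mathbb{E}$ denote the expectation over $G$. Let $P$ be the transition matrix of the simple random walk on $G$, $P(x,y) = 1/D_x^+$ if $x\to y$ and $P(x,y)=0$ otherwise, where $D_x^+$ is the out-degree of $x$. Let $U$ be the event that there is exactly one probability vector $\pi$ on $[n]$ with $\pi P = \pi$, and on $U$ let $\pi$ be this stationary distribution. Then $$\mathbb{E}\Big[\mathbf{1}_{U}\sum_{x\in[n]}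 \pi(x)^2\Big] \le C_1\, \frac{\log^6 n}{n}.$$ -/

import Mathlib

open MeasureTheory
open scoped Matrix

noncomputable section

namespace ChungLu

variable {n : ℕ}

/-- The probability `p_{xy} = min (w_x⁺ w_y⁻ log n / n) 1` of the oriented edge `x → y`, for `x ≠ y`;
there are no loops. (For nonnegative weights the `max` changes nothing.) -/
def edgeProb (wOut wIn : Fin n → ℝ) (x y : Fin n) : unitInterval :=
  if x = y then 0
  else ⟨max 0 (min (wOut x * wIn y * (Real.log n / n)) 1),
    le_max_left _ _, max_le zero_le_one (min_le_right _ _)⟩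

/-- A digraph on `{1, …, n}`, given by its adjacency matrix: `G x y = true` means `x → y`. -/
abbrev Graph (n : ℕ) : Type := Fin n → Fin n → Bool

/-- The law of the Chung–Lu digraph: the edges are independent, and `x → y` is present with
probability `edgeProb wOut wIn x y`. -/
def law (wOut wIn : Fin n → ℝ) : Measure (Graph n) :=
  Measure.pi fun x => Measure.pi fun y =>
    ProbabilityTheory.bernoulliMeasure true false (edgeProb wOut wIn x y)

/-- The out-degree `D_x⁺`. -/
def outDegree (G : Graph n) (x : Fin n) : ℕ :=
  (Finset.univ.filter fun y => G x y = true).card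

/-- The transition matrix of the simple random walk: `P(x, y) = 1 / D_x⁺` if `x → y`, and `0`
otherwise (so the row of a vertex without out-neighbours is zero). -/
def transition (G : Graph n) : Matrix (Fin n) (Fin n) ℝ :=
  Matrix.of fun x y => if G x y = true then 1 / (outDegree G x : ℝ) else 0

/-- `π` is a probability vector with `π P = π`. -/
def IsStationary (G : Graph n) (π : Fin n → ℝ) : Prop :=
  π ∈ stdSimplex ℝ (Fin n) ∧ π ᵥ* transition G = π

/-- The event that the walk has exactly one stationary distribution. -/
def uniqueEvent (n : ℕ) : Set (Graph n) :=
  {G | ∃! π : Fin n → ℝ, IsStationary G π}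

open Classical in
/-- The stationary distribution of the walk on `G`, when it exists and is unique (the value outside
`uniqueEvent n` is a placeholder). -/
def stationary (G : Graph n) : Fin n → ℝ :=
  if h : ∃! π : Fin n → ℝ, IsStationary G π then h.choose else 0

end ChungLu

end

/-! Let v(z) be the in-weight of z divided by the total in-weight, and let N be P with v subtracted
from every nonzero row (`centredMatrix`). A stationary π puts no mass on vanishing rows, so πN = π −
v, and iteration gives π = Σ_{s<t} vN^s + πN^t. By Cauchy–Schwarz, ‖π‖² is at most 2t Σ_{s<t}
‖vN^s‖² plus twice the squared Frobenius norm of N^t (`sum_sq_le_of_vecMul_eq`). With t of order log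
n it suffices that E‖vN^s‖² = O(1/n) and that the expected squared Frobenius norm is at most 1/n.
This gives log² n / n, which is stronger than needed.

Both expectations expand into pairs of walks with a common end. Rows are independent, so each pair
contributes a product of row moments. If the out-degree of a row is at least Λ = δ log n, its
entries are at most 1/Λ on edges, plus v; smaller out-degrees cost β = n^{-(1+κ)} by a Chernoff
bound, where κ > 0 because M₀ > 1 (`abs_integral_prod_centredRow_le`). Thus a pair of walks weighs
about a product over its distinct edges times Λ to the power of its excess (edges + 2 − vertices),
and an exploration argument sums these weights at a cost of K + 2 per step (`sum_walkPairs_le`).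

For distinct starts x ≠ y, a start that is never revisited has a row used exactly once, so it
contributes the mean of a centred entry. This mean carries a factor ε = n^{-1/2-d} up to logarithms
(`abs_integral_centredRow_le`); d > 0 because the bound on the (2+η)-th moment forces every
in-weight to be O(n^{1/(2+η)}). A revisited start creates excess, which costs as much. Two such
factors give O(1/n) (`Controlled.offDiag_le`). The terms x = y contribute at most 4 Σ v², again
O(1/n).

For N^t, either two rows have small out-degree, at cost β², or at most one does. A walk leaves a
given vertex along a non-loop at most every other step, and loop entries are small in any case, so
at least t − 1 factors Λ^{-1/2} survive. For t of order log n this beats every power of n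
(`Controlled.diag_le`). -/

noncomputable section

namespace ChungLu

/-! ### Walks and weighted sums over pairs of walks. -/

section Walks

variable {V : Type*}

/-- The steps of the walk that starts at `x` and then visits the vertices in the list. -/
def walkEdges : V → List V → List (V × V)
  | _, [] => []
  | x, z :: l => (x, z) :: walkEdges z l

/-- The final vertex of the walk that starts at `x` and then visits the vertices in the list. -/
def walkEnd : V → List V → V
  | x, [] => x
  | _, z :: l => walkEnd z l

theorem length_walkEdges (x : V) (l : List V) : (walkEdges x l).length = l.length := by
  induction l generalizing x with
  | nil => rfl
  | cons z l ih => simp [walkEdges, ih]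

theorem mem_of_walkEdges (x : V) (l : List V) {e : V × V} (he : e ∈ walkEdges x l) :
    e.1 ∈ x :: l ∧ e.2 ∈ l := by
  induction l generalizing x with
  | nil => simp [walkEdges] at he
  | cons z l ih =>
    rcases List.mem_cons.1 he with rfl | he
    · simp
    · have := ih z he
      exact ⟨List.mem_cons_of_mem _ this.1, List.mem_cons_of_mem _ this.2⟩

theorem exists_mem_walkEdges_of_mem (x : V) (l : List V) {z : V} (hz : z ∈ l) :
    ∃ u, (u, z) ∈ walkEdges x l := by
  induction l generalizing x with
  | nil => simp at hz
  | cons y l ih =>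
    rcases List.mem_cons.1 hz with rfl | hz
    · exact ⟨x, by simp [walkEdges]⟩
    · obtain ⟨u, hu⟩ := ih y hz
      exact ⟨u, List.mem_cons_of_mem _ hu⟩

theorem source_or_end (x : V) (l : List V) {z : V} (hz : z ∈ x :: l) :
    z = walkEnd x l ∨ ∃ u, (z, u) ∈ walkEdges x l := by
  induction l generalizing x with
  | nil => exact Or.inl (by simpa [walkEnd] using hz)
  | cons y l ih =>
    rcases List.mem_cons.1 hz with rfl | hz
    · exact Or.inr ⟨y, by simp [walkEdges]⟩
    · rcases ih y hz with h | ⟨u, hu⟩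
      · exact Or.inl h
      · exact Or.inr ⟨u, List.mem_cons_of_mem _ hu⟩

variable [DecidableEq V]

/-- A walk leaves a given vertex along a non-loop at most every other step. -/
theorem two_mul_nonloop_le (x a : V) (l : List V) :
    2 * (walkEdges a l).countP (fun e => e.1 = x ∧ e.2 ≠ x) ≤ l.length + if a = x then 1 else 0 := by
  induction l generalizing a with
  | nil => simp [walkEdges]
  | cons z l ih =>
    have := ih z
    simp only [walkEdges, List.countP_cons, List.length_cons]
    by_cases h1 : a = x <;> by_cases h2 : z = x <;> simp_all <;> omega

theorem card_insert_heads_le (x y : V) (F : Finset (V × V)) (l : List V)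
    (h : ∀ z ∈ l, ∃ u, (u, z) ∈ F) : (({x, y} : Finset V) ∪ l.toFinset).card ≤ F.card + 2 := by
  have h1 : l.toFinset ⊆ F.image Prod.snd := by
    intro z hz
    obtain ⟨u, hu⟩ := h z (by simpa using hz)
    exact Finset.mem_image.2 ⟨_, hu, rfl⟩
  have h2 := (Finset.card_le_card h1).trans Finset.card_image_le
  have h3 := Finset.card_union_le ({x, y} : Finset V) l.toFinset
  have h4 := Finset.card_le_two (a := x) (b := y)
  omega

variable [Fintype V]

/-- The lists of a given length. -/
def lists (V : Type*) [DecidableEq V] [Fintype V] : ℕ → Finset (List V)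
  | 0 => {[]}
  | s + 1 => (Finset.univ ×ˢ lists V s).image fun p => p.1 :: p.2

theorem length_of_mem_lists {s : ℕ} {l : List V} (h : l ∈ lists V s) : l.length = s := by
  induction s generalizing l with
  | zero => simpa [lists] using h
  | succ s ih =>
    obtain ⟨⟨z, l'⟩, h', rfl⟩ := Finset.mem_image.1 h
    simp [ih (Finset.mem_product.1 h').2]

theorem sum_lists_succ {M : Type*} [AddCommMonoid M] (s : ℕ) (f : List V → M) :
    ∑ l ∈ lists V (s + 1), f l = ∑ z, ∑ l ∈ lists V s, f (z :: l) := by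
  rw [lists, Finset.sum_image, Finset.sum_product]
  rintro ⟨a, l⟩ - ⟨b, l'⟩ - h
  simpa using h

theorem matrix_pow_apply (N : Matrix V V ℝ) (s : ℕ) (x z : V) :
    (N ^ s) x z = ∑ l ∈ lists V s,
      if walkEnd x l = z then ((walkEdges x l).map fun e => N e.1 e.2).prod else 0 := by
  induction s generalizing x with
  | zero => simp [lists, walkEnd, walkEdges, Matrix.one_apply]
  | succ s ih =>
    rw [pow_succ', Matrix.mul_apply, sum_lists_succ]
    refine Finset.sum_congr rfl fun u _ => ?_
    rw [ih, Finset.mul_sum]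
    refine Finset.sum_congr rfl fun l _ => ?_
    simp [walkEnd, walkEdges]

theorem sum_pow_mul_pow (N : Matrix V V ℝ) (s : ℕ) (x y : V) :
    ∑ z, (N ^ s) x z * (N ^ s) y z = ∑ l ∈ lists V s, ∑ l' ∈ lists V s,
      if walkEnd x l = walkEnd y l' then
        ((walkEdges x l ++ walkEdges y l').map fun e => N e.1 e.2).prod else 0 := by
  simp_rw [matrix_pow_apply, Finset.sum_mul_sum]
  rw [Finset.sum_comm]
  refine Finset.sum_congr rfl fun l _ => ?_
  rw [Finset.sum_comm]
  refine Finset.sum_congr rfl fun l' _ => ?_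
  simp only [ite_mul, zero_mul, mul_ite, mul_zero, Finset.sum_ite_eq, Finset.mem_univ, if_true,
    List.map_append, List.prod_append]

/-- The number of edges in `F` out of a vertex, plus the number of all sources. -/
theorem outdeg_add_card_sources_le (F : Finset (V × V)) (x : V) :
    (Finset.univ.filter fun z => (x, z) ∈ F).card + (F.image Prod.fst).card ≤ F.card + 1 := by
  have h1 : F.card = ((F.filter fun e => e.1 = x).card) + (F.filter fun e => ¬ e.1 = x).card :=
    (Finset.card_filter_add_card_filter_not _).symm
  have h2 : (Finset.univ.filter fun z => (x, z) ∈ F).card ≤ (F.filter fun e => e.1 = x).card := by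
    refine Finset.card_le_card_of_injOn (fun z => (x, z)) (fun z hz => ?_) (fun a _ b _ h => ?_)
    · simpa using hz
    · simpa using h
  have h3 : (F.image Prod.fst).card ≤ (F.filter fun e => ¬ e.1 = x).card + 1 := by
    calc (F.image Prod.fst).card ≤ (insert x ((F.filter fun e => ¬ e.1 = x).image Prod.fst)).card := by
          refine Finset.card_le_card fun u hu => ?_
          obtain ⟨e, he, rfl⟩ := Finset.mem_image.1 hu
          by_cases h : e.1 = x
          · simp [h]
          · exact Finset.mem_insert_of_mem (Finset.mem_image_of_mem _ (by simp [he, h]))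
      _ ≤ _ := (Finset.card_insert_le _ _).trans (Nat.add_le_add_right Finset.card_image_le _)
  omega

/-- Continuations of a walk, weighted by the product of `q` over the distinct edges and by a
factor `ρ` for each new edge that ends at an old vertex. -/
theorem sum_continuations_le (q : V × V → ℝ) (hq : ∀ e, 0 ≤ q e) {K Q ρ : ℝ} (hK : 0 ≤ K)
    (hρ : 0 ≤ ρ) (hqK : ∀ x, ∑ z ∈ Finset.univ.erase x, q (x, z) ≤ K) (hqQ : ∀ e, q e ≤ Q)
    {L S : ℕ} (hL : L * (ρ * Q) * 2 ^ S ≤ 1)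
    (s : ℕ) (hs : s ≤ S) (F : Finset (V × V)) (W : Finset V) (x a : V) (c : ℕ)
    (hc : F.card + 2 = W.card + c) (hF : ∀ e ∈ F, e.2 ∈ W) (hx : x ∈ W)
    (hW : W ⊆ insert a (insert x (F.image Prod.fst))) (hWL : W.card + s ≤ L) :
    ∑ l ∈ lists V s, (∏ e ∈ F ∪ (walkEdges x l).toFinset, q e) *
        ρ ^ ((F ∪ (walkEdges x l).toFinset).card + 2 - (W ∪ l.toFinset).card) ≤
      (∏ e ∈ F, q e) * ρ ^ c * ((K + 2) ^ s * 2 ^ (s * c)) := by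
  induction s generalizing F W x c with
  | zero =>
    simp only [lists, Finset.sum_singleton, walkEdges, List.toFinset_nil, Finset.union_empty]
    rw [show F.card + 2 - W.card = c by omega]; simp
  | succ s ih =>
    have hP : 0 ≤ ∏ e ∈ F, q e := Finset.prod_nonneg fun e _ => hq e
    rw [sum_lists_succ]
    set B : ℝ := (∏ e ∈ F, q e) * ρ ^ c * ((K + 2) ^ s * 2 ^ (s * c)) with hB
    have hB0 : 0 ≤ B := by positivity
    have hWs : W.card ≤ (F.image Prod.fst).card + 2 :=
      (Finset.card_le_card hW).trans <| (Finset.card_insert_le _ _).trans <|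
        Nat.add_le_add_right (Finset.card_insert_le _ _) 1
    -- All but at most two vertices of `W` are sources of edges in `F`, so a large out-degree at `x`
    -- forces excess. This bounds the number of ways to repeat an edge.
    have hdeg : (Finset.univ.filter fun z => (x, z) ∈ F).card ≤ c + 1 := by
      have := outdeg_add_card_sources_le F x; omega
    have hcond : ∀ z : V, W ⊆ insert a (insert z ((insert (x, z) F).image Prod.fst)) := by
      intro z u hu
      have := hW hu
      simp only [Finset.mem_insert, Finset.image_insert] at this ⊢
      tauto
    -- The three terms are: repeat an old edge, close up along a new edge to an old vertex (`c`
    -- grows by one), or discover a new vertex.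
    have step : ∀ z : V, ∑ l ∈ lists V s, (∏ e ∈ F ∪ (walkEdges x (z :: l)).toFinset, q e) *
          ρ ^ ((F ∪ (walkEdges x (z :: l)).toFinset).card + 2 - (W ∪ (z :: l).toFinset).card) ≤
        (if (x, z) ∈ F then B else 0) + (if z ∈ W then B * (ρ * Q * 2 ^ S) else 0)
          + (if z ≠ x then B * q (x, z) else 0) := by
      intro z
      have e1 : ∀ l : List V, F ∪ (walkEdges x (z :: l)).toFinset
          = insert (x, z) F ∪ (walkEdges z l).toFinset := by
        intro l; ext e; simp [walkEdges]
      have e2 : ∀ l : List V, W ∪ (z :: l).toFinset = insert z W ∪ l.toFinset := by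
        intro l; ext e; simp
      simp only [e1, e2]
      have t1 : 0 ≤ (if (x, z) ∈ F then B else 0) := by split_ifs <;> simp [hB0]
      have hQ0 : 0 ≤ Q := (hq (x, x)).trans (hqQ _)
      have t2 : 0 ≤ (if z ∈ W then B * (ρ * Q * 2 ^ S) else 0) := by split_ifs <;> positivity
      have t3 : 0 ≤ (if z ≠ x then B * q (x, z) else 0) := by
        have := hq (x, z)
        split_ifs <;> positivity
      by_cases h1 : (x, z) ∈ F
      · have hz : z ∈ W := hF _ h1
        have := ih (by omega) F W z c hc hF hz (by simpa [Finset.insert_eq_of_mem h1] using hcond z)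
          (by omega)
        rw [Finset.insert_eq_of_mem h1, Finset.insert_eq_of_mem hz]
        rw [if_pos h1] at t1 ⊢
        linarith
      · by_cases h2 : z ∈ W
        · have hcard := Finset.card_insert_of_notMem h1
          have := ih (by omega) (insert (x, z) F) W z (c + 1) (by omega)
            (by
              intro e he
              rcases Finset.mem_insert.1 he with rfl | he
              · exact h2
              · exact hF e he) h2 (hcond z) (by omega)
          rw [Finset.insert_eq_of_mem h2]
          refine this.trans ?_
          rw [Finset.prod_insert h1, if_pos h2]
          have : q (x, z) * (∏ e ∈ F, q e) * ρ ^ (c + 1) * ((K + 2) ^ s * 2 ^ (s * (c + 1)))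
              = B * (ρ * q (x, z) * 2 ^ s) := by rw [hB]; ring
          rw [this]
          -- Raising `c` by one turns `2 ^ (s * c)` into `2 ^ (s * (c + 1))`; the factor `2 ^ S` in
          -- `hL` pays for this.
          have : B * (ρ * q (x, z) * 2 ^ s) ≤ B * (ρ * Q * 2 ^ S) := by
            have h2S : (2 : ℝ) ^ s ≤ 2 ^ S := pow_le_pow_right₀ (by norm_num) (by omega)
            have := hqQ (x, z)
            have := hq (x, z)
            gcongr
          linarith
        · have hcard := Finset.card_insert_of_notMem h1
          have hcardW := Finset.card_insert_of_notMem h2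
          have := ih (by omega) (insert (x, z) F) (insert z W) z c (by omega)
            (by
              intro e he
              rcases Finset.mem_insert.1 he with rfl | he
              · exact Finset.mem_insert_self _ _
              · exact Finset.mem_insert_of_mem (hF e he)) (Finset.mem_insert_self _ _)
            (by
              refine Finset.insert_subset ?_ (hcond z)
              simp) (by omega)
          refine this.trans ?_
          have hzx : z ≠ x := fun h => h2 (h ▸ hx)
          rw [Finset.prod_insert h1, if_pos hzx]
          have : q (x, z) * (∏ e ∈ F, q e) * ρ ^ c * ((K + 2) ^ s * 2 ^ (s * c))
              = B * q (x, z) := by rw [hB]; ring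
          linarith
    refine (Finset.sum_le_sum fun z _ => step z).trans ?_
    rw [Finset.sum_add_distrib, Finset.sum_add_distrib]
    have s1 : ∑ z, (if (x, z) ∈ F then B else 0) ≤ (c + 1) * B := by
      rw [← Finset.sum_filter, Finset.sum_const, nsmul_eq_mul]
      gcongr
      exact_mod_cast hdeg
    have s2 : ∑ z, (if z ∈ W then B * (ρ * Q * 2 ^ S) else 0) ≤ B := by
      have hQ0 : 0 ≤ Q := (hq (x, x)).trans (hqQ _)
      rw [← Finset.sum_filter, Finset.sum_const, nsmul_eq_mul, Finset.filter_mem_eq_inter,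
        Finset.univ_inter]
      calc (W.card : ℝ) * (B * (ρ * Q * 2 ^ S)) ≤ L * (B * (ρ * Q * 2 ^ S)) := by
            gcongr; omega
        _ = B * (L * (ρ * Q) * 2 ^ S) := by ring
        _ ≤ B * 1 := by gcongr
        _ = B := mul_one B
    have s3 : ∑ z, (if z ≠ x then B * q (x, z) else 0) ≤ B * K := by
      rw [← Finset.sum_filter, ← Finset.mul_sum]
      refine mul_le_mul_of_nonneg_left (le_trans (le_of_eq ?_) (hqK x)) hB0
      congr 1; ext z; simp
    have hc2 : (c : ℝ) + 2 ≤ 2 * 2 ^ c := by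
      have h : ∀ m : ℕ, m + 2 ≤ 2 * 2 ^ m := by
        intro m
        induction m with
        | zero => norm_num
        | succ m ih => rw [pow_succ]; omega
      exact_mod_cast h c
    have hfin : (∏ e ∈ F, q e) * ρ ^ c * ((K + 2) ^ (s + 1) * 2 ^ ((s + 1) * c))
        = B * ((K + 2) * 2 ^ c) := by rw [hB]; ring
    rw [hfin]
    have h2c : (1 : ℝ) ≤ 2 ^ c := one_le_pow₀ (by norm_num)
    calc _ ≤ (c + 1) * B + B + B * K := by linarith
      _ = B * (c + 2 + K) := by ring
      _ ≤ B * ((K + 2) * 2 ^ c) := by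
        refine mul_le_mul_of_nonneg_left ?_ hB0
        nlinarith

/-- The edges used by a pair of walks. -/
def pairEdges (x y : V) (l l' : List V) : Finset (V × V) :=
  (walkEdges x l ++ walkEdges y l').toFinset

/-- The vertices visited by a pair of walks. -/
def pairVerts (x y : V) (l l' : List V) : Finset V := {x, y} ∪ l.toFinset ∪ l'.toFinset

/-- The excess of the graph spanned by a pair of walks. -/
def excess (x y : V) (l l' : List V) : ℕ :=
  (pairEdges x y l l').card + 2 - (pairVerts x y l l').card

/-- Apply `sum_continuations_le` twice. The second walk continues from the graph of the first and
costs `2 ^ s` per unit of excess already present, which replaces `ρ` by `ρ * 2 ^ s` when the first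
walk is summed. Equal starts already have excess one, hence the extra factor. -/
theorem sum_walkPairs_le (q : V × V → ℝ) (hq : ∀ e, 0 ≤ q e) {K Q ρ : ℝ} (hK : 0 ≤ K)
    (hρ : 0 ≤ ρ) (hqK : ∀ x, ∑ z ∈ Finset.univ.erase x, q (x, z) ≤ K) (hqQ : ∀ e, q e ≤ Q)
    (s : ℕ) (hL : (2 * s + 2 : ℕ) * (ρ * Q) * 4 ^ s ≤ 1) (x y : V) :
    ∑ l ∈ lists V s, ∑ l' ∈ lists V s, (∏ e ∈ pairEdges x y l l', q e) * ρ ^ excess x y l l' ≤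
      (K + 2) ^ (2 * s) * (ρ * 4 ^ s) ^ (if x = y then 1 else 0) := by
  have hQ0 : 0 ≤ Q := (hq (x, x)).trans (hqQ _)
  have h24 : (2 : ℝ) ^ s ≤ 4 ^ s := by gcongr; norm_num
  have hL1 : (2 * s + 2 : ℕ) * (ρ * Q) * 2 ^ s ≤ 1 := le_trans (by gcongr) hL
  have hL2 : (2 * s + 2 : ℕ) * ((ρ * 2 ^ s) * Q) * 2 ^ s ≤ 1 := by
    refine le_trans (le_of_eq ?_) hL
    rw [show (4 : ℝ) = 2 * 2 by norm_num, mul_pow]; ring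
  have hcard2 := Finset.card_le_two (a := x) (b := y)
  have inner : ∀ l ∈ lists V s, ∑ l' ∈ lists V s, (∏ e ∈ pairEdges x y l l', q e) *
      ρ ^ excess x y l l' ≤ (K + 2) ^ s * ((∏ e ∈ ∅ ∪ (walkEdges x l).toFinset, q e) *
        (ρ * 2 ^ s) ^ ((∅ ∪ (walkEdges x l).toFinset).card + 2
          - (({x, y} : Finset V) ∪ l.toFinset).card)) := by
    intro l hl
    have hlen := length_of_mem_lists hl
    rw [Finset.empty_union]
    have hle := card_insert_heads_le x y (walkEdges x l).toFinset l
      (fun z hz => by simpa using exists_mem_walkEdges_of_mem x l hz)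
    have := sum_continuations_le q hq hK hρ hqK hqQ hL1 s le_rfl (walkEdges x l).toFinset
      ({x, y} ∪ l.toFinset) y (walkEnd x l) _ (by omega :
        (walkEdges x l).toFinset.card + 2 = (({x, y} : Finset V) ∪ l.toFinset).card +
          ((walkEdges x l).toFinset.card + 2 - (({x, y} : Finset V) ∪ l.toFinset).card))
      (fun e he => by
        have := (mem_of_walkEdges x l (by simpa using he)).2
        simp [this]) (by simp) (by
        intro z hz
        have hz' : z = y ∨ z ∈ x :: l := by
          simp only [Finset.mem_union, Finset.mem_insert, Finset.mem_singleton,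
            List.mem_toFinset] at hz
          simp only [List.mem_cons]; tauto
        rcases hz' with rfl | hz'
        · simp
        · rcases source_or_end x l hz' with h | ⟨u, hu⟩
          · simp [h]
          · refine Finset.mem_insert_of_mem (Finset.mem_insert_of_mem ?_)
            exact Finset.mem_image.2 ⟨(z, u), by simpa using hu, rfl⟩)
      (by
        have h3 := Finset.card_union_le ({x, y} : Finset V) l.toFinset
        have := List.toFinset_card_le l
        omega)
    simp only [pairEdges, excess, pairVerts, List.toFinset_append]
    refine this.trans (le_of_eq ?_)
    rw [mul_pow, pow_mul]; ring
  refine (Finset.sum_le_sum inner).trans ?_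
  rw [← Finset.mul_sum]
  have h0 := sum_continuations_le q hq hK (by positivity : 0 ≤ ρ * 2 ^ s) hqK hqQ hL2 s le_rfl ∅
      {x, y} x y (if x = y then 1 else 0) (by
        by_cases h : x = y
        · simp [h]
        · simp [h]) (by simp) (by simp) (by
          intro z hz
          simp only [Finset.mem_insert, Finset.mem_singleton] at hz ⊢; tauto) (by omega)
  refine (mul_le_mul_of_nonneg_left h0 (by positivity)).trans (le_of_eq ?_)
  rw [Finset.prod_empty]
  have h4 : (4 : ℝ) ^ s = 2 ^ s * 2 ^ s := by rw [← mul_pow]; norm_num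
  rw [h4]
  split_ifs
  · rw [mul_one]
    generalize (2 : ℝ) ^ s = u
    ring
  · ring

end Walks

/-! ### Multiplicities, excess and the factorisation of a pair of walks over rows. -/

section Patterns

variable {V : Type*} [DecidableEq V]

theorem card_pairVerts_le_sources (x y : V) (l l' : List V) :
    (pairVerts x y l l').card ≤ ((pairEdges x y l l').image Prod.fst).card + 2 := by
  have : pairVerts x y l l' ⊆ insert (walkEnd x l) (insert (walkEnd y l')
      ((pairEdges x y l l').image Prod.fst)) := by
    intro z hz
    have hz' : z ∈ x :: l ∨ z ∈ y :: l' := by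
      simp only [pairVerts, Finset.mem_union, Finset.mem_insert, Finset.mem_singleton,
        List.mem_toFinset] at hz
      simp only [List.mem_cons]; tauto
    rcases hz' with hz | hz
    · rcases source_or_end x l hz with h | ⟨u, hu⟩
      · simp [h]
      · refine Finset.mem_insert_of_mem (Finset.mem_insert_of_mem ?_)
        exact Finset.mem_image.2 ⟨(z, u), by simp [pairEdges, hu], rfl⟩
    · rcases source_or_end y l' hz with h | ⟨u, hu⟩
      · simp [h]
      · refine Finset.mem_insert_of_mem (Finset.mem_insert_of_mem ?_)
        exact Finset.mem_image.2 ⟨(z, u), by simp [pairEdges, hu], rfl⟩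
  have h1 := Finset.card_le_card this
  have h2 := Finset.card_insert_le (walkEnd x l) (insert (walkEnd y l')
      ((pairEdges x y l l').image Prod.fst))
  have h3 := Finset.card_insert_le (walkEnd y l') ((pairEdges x y l l').image Prod.fst)
  omega

/-- A row with k distinct targets contributes `Λ ^ (k - 1)`; over all rows the exponents add up to
edges minus sources. Only the two endpoints may fail to be sources, so the excess dominates. -/
theorem card_edges_sub_sources_le (x y : V) (l l' : List V) :
    (pairEdges x y l l').card - ((pairEdges x y l l').image Prod.fst).card
      ≤ excess x y l l' := by
  have := card_pairVerts_le_sources x y l l'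
  rw [excess]; omega

/-- The starting points of a pair of walks that are never visited later. -/
def isolatedStarts (x y : V) (l l' : List V) : Finset V :=
  ({x, y} : Finset V).filter fun u => u ∉ l ∧ u ∉ l'

/-- Every visited vertex other than an isolated start is the head of an edge. This inequality later
yields two small factors for every pair of walks with distinct starts. -/
theorem two_le_excess_add (x y : V) (l l' : List V) :
    2 ≤ excess x y l l' + (isolatedStarts x y l l').card := by
  have : pairVerts x y l l' ⊆ isolatedStarts x y l l' ∪ (pairEdges x y l l').image Prod.snd := by
    intro z hz
    by_cases h : z ∈ l ∨ z ∈ l'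
    · refine Finset.mem_union_right _ (Finset.mem_image.2 ?_)
      rcases h with h | h
      · obtain ⟨u, hu⟩ := exists_mem_walkEdges_of_mem x l h
        exact ⟨(u, z), by simp [pairEdges, hu], rfl⟩
      · obtain ⟨u, hu⟩ := exists_mem_walkEdges_of_mem y l' h
        exact ⟨(u, z), by simp [pairEdges, hu], rfl⟩
    · refine Finset.mem_union_left _ ?_
      simp only [pairVerts, Finset.mem_union, List.mem_toFinset] at hz
      simp only [isolatedStarts, Finset.mem_filter]
      tauto
  have h1 := Finset.card_le_card this
  have h2 := Finset.card_union_le (isolatedStarts x y l l') ((pairEdges x y l l').image Prod.snd)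
  have h3 : ((pairEdges x y l l').image Prod.snd).card ≤ (pairEdges x y l l').card :=
    Finset.card_image_le
  rw [excess]; omega

theorem count_walkEdges_of_not_mem (x u : V) (l : List V) (hx : u ≠ x) (hu : u ∉ l) (z : V) :
    (walkEdges x l).count (u, z) = 0 := by
  refine List.count_eq_zero.2 fun h => ?_
  have := (mem_of_walkEdges x l h).1
  simp [hx, hu] at this

theorem count_walkEdges_start (x : V) (l : List V) (hx : x ∉ l) (hl : l ≠ []) :
    ∃ z, z ≠ x ∧ ∀ u, (walkEdges x l).count (x, u) = if u = z then 1 else 0 := by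
  cases l with
  | nil => simp at hl
  | cons z l =>
    simp only [List.mem_cons, not_or] at hx
    refine ⟨z, fun h => hx.1 h.symm, fun u => ?_⟩
    rw [walkEdges, List.count_cons, count_walkEdges_of_not_mem z x l hx.1 hx.2]
    simp [@eq_comm _ u z]

theorem count_isolatedStarts {x y u : V} (hxy : x ≠ y) {l l' : List V} (hl : l ≠ [])
    (hl' : l' ≠ []) (hu : u ∈ isolatedStarts x y l l') :
    ∃ z, z ≠ u ∧ ∀ w, (walkEdges x l ++ walkEdges y l').count (u, w) = if w = z then 1 else 0 := by
  simp only [isolatedStarts, Finset.mem_filter, Finset.mem_insert, Finset.mem_singleton] at hu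
  obtain ⟨rfl | rfl, h1, h2⟩ := hu
  · obtain ⟨z, hz, h⟩ := count_walkEdges_start u l h1 hl
    exact ⟨z, hz, fun w => by
      rw [List.count_append, h, count_walkEdges_of_not_mem y u l' hxy h2, add_zero]⟩
  · obtain ⟨z, hz, h⟩ := count_walkEdges_start u l' h2 hl'
    exact ⟨z, hz, fun w => by
      rw [List.count_append, h, count_walkEdges_of_not_mem x u l hxy.symm h1, zero_add]⟩

variable [Fintype V]

theorem sum_count_row (el : List (V × V)) (x : V) :
    ∑ z ∈ Finset.univ.erase x, el.count (x, z) = el.countP fun e => e.1 = x ∧ e.2 ≠ x := by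
  induction el with
  | nil => simp
  | cons e el ih =>
    simp only [List.count_cons, List.countP_cons, Finset.sum_add_distrib, ih]
    congr 1
    obtain ⟨u, z⟩ := e
    by_cases h1 : u = x <;> by_cases h2 : z = x <;> simp [h1, h2]

theorem sum_sum_count (el : List (V × V)) : ∑ x, ∑ z, el.count (x, z) = el.length := by
  rw [← Fintype.sum_prod_type' (fun (x z : V) => el.count (x, z)),
    ← List.sum_toFinset_count_eq_length]
  have h : ∀ e ∈ Finset.univ, e ∉ el.toFinset → el.count e = 0 := fun e _ he => by
    simpa [List.count_eq_zero] using he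
  rw [lawful_beq_subsingleton (α := V × V) instBEqOfDecidableEq instBEqProd]
  exact (Finset.sum_subset (Finset.subset_univ el.toFinset) h).symm

theorem prod_map_eq_prod_rows (el : List (V × V)) (N : Matrix V V ℝ) :
    (el.map fun e => N e.1 e.2).prod = ∏ x, ∏ z, N x z ^ el.count (x, z) := by
  rw [Finset.prod_list_map_count, ← Fintype.prod_prod_type'
    (fun (x z : V) => N x z ^ el.count (x, z))]
  have h : ∀ e ∈ Finset.univ, e ∉ el.toFinset → N e.1 e.2 ^ el.count e = 1 := fun e _ he => by
    rw [List.count_eq_zero.2 (by simpa using he), pow_zero]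
  rw [lawful_beq_subsingleton (α := V × V) instBEqOfDecidableEq instBEqProd]
  exact Finset.prod_subset (Finset.subset_univ el.toFinset) h

/-- The targets of a multiplicity function on a row. -/
def rowSupport (m : V → ℕ) : Finset V := Finset.univ.filter fun z => m z ≠ 0

theorem prod_rows_le (el : List (V × V)) (q : V × V → ℝ) {Λ : ℝ}
    (r ψ : V → ℝ) (hr0 : ∀ u, 0 ≤ r u)
    (hr1 : ∀ u ∉ el.toFinset.image Prod.fst, r u = 1)
    (hr : ∀ u ∈ el.toFinset.image Prod.fst, r u ≤ 4 ^ (∑ z, el.count (u, z)) *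
      (∏ z ∈ rowSupport fun z => el.count (u, z), q (u, z)) *
      Λ ^ ((rowSupport fun z => el.count (u, z)).card - 1) * ψ u) :
    ∏ u, r u ≤ 4 ^ el.length * (∏ e ∈ el.toFinset, q e) *
      Λ ^ (el.toFinset.card - (el.toFinset.image Prod.fst).card) *
        ∏ u ∈ el.toFinset.image Prod.fst, ψ u := by
  set S := el.toFinset.image Prod.fst with hS
  have hsupp : ∀ u z, z ∈ (rowSupport fun z => el.count (u, z)) ↔ (u, z) ∈ el.toFinset := by
    intro u z; simp [rowSupport, List.count_eq_zero]
  have hfib : ∀ u ∈ S, (rowSupport fun z => el.count (u, z)).card =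
      (el.toFinset.filter fun e => e.1 = u).card := by
    intro u _
    refine Finset.card_bij (fun z _ => (u, z)) ?_ ?_ ?_
    · intro z hz; simpa using (hsupp u z).1 hz
    · intro a _ b _ h; simpa using h
    · rintro ⟨a, z⟩ hb
      obtain ⟨h1, rfl⟩ := Finset.mem_filter.1 hb
      exact ⟨z, (hsupp _ _).2 h1, rfl⟩
  have hfib1 : ∀ u ∈ S, 1 ≤ (rowSupport fun z => el.count (u, z)).card := by
    intro u hu
    obtain ⟨e, he, rfl⟩ := Finset.mem_image.1 hu
    exact Finset.card_pos.2 ⟨e.2, (hsupp _ _).2 he⟩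
  have h4 : ∑ u ∈ S, ∑ z, el.count (u, z) = el.length := by
    rw [← sum_sum_count]
    refine Finset.sum_subset (Finset.subset_univ _) fun u _ hu => ?_
    refine Finset.sum_eq_zero fun z _ => List.count_eq_zero.2 fun h => hu ?_
    exact Finset.mem_image.2 ⟨(u, z), by simpa using h, rfl⟩
  have hΛ : ∑ u ∈ S, ((rowSupport fun z => el.count (u, z)).card - 1)
      = el.toFinset.card - S.card := by
    rw [Finset.sum_tsub_distrib _ hfib1, Finset.sum_congr rfl hfib,
      ← Finset.card_eq_sum_card_fiberwise fun e he => Finset.mem_image_of_mem _ he]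
    simp
  have hprod : ∏ u ∈ S, ∏ z ∈ rowSupport (fun z => el.count (u, z)), q (u, z)
      = ∏ e ∈ el.toFinset, q e := by
    rw [← Finset.prod_fiberwise_of_maps_to
      (fun e he => Finset.mem_image_of_mem Prod.fst he) q]
    refine Finset.prod_congr rfl fun u _ => ?_
    refine Finset.prod_bij (fun z _ => (u, z)) ?_ ?_ ?_ (fun _ _ => rfl)
    · intro z hz; simpa using (hsupp u z).1 hz
    · intro a _ b _ h; simpa using h
    · rintro ⟨a, z⟩ hb
      obtain ⟨h1, rfl⟩ := Finset.mem_filter.1 hb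
      exact ⟨z, (hsupp _ _).2 h1, rfl⟩
  calc ∏ u, r u = ∏ u ∈ S, r u :=
        (Finset.prod_subset (Finset.subset_univ _) fun u _ hu => hr1 u hu).symm
    _ ≤ ∏ u ∈ S, (4 ^ (∑ z, el.count (u, z)) *
      (∏ z ∈ rowSupport fun z => el.count (u, z), q (u, z)) *
      Λ ^ ((rowSupport fun z => el.count (u, z)).card - 1) * ψ u) :=
        Finset.prod_le_prod (fun u _ => hr0 u) hr
    _ = _ := by
      rw [Finset.prod_mul_distrib, Finset.prod_mul_distrib, Finset.prod_mul_distrib,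
        Finset.prod_pow_eq_pow_sum, Finset.prod_pow_eq_pow_sum, h4, hΛ, hprod]

/-- If the second entry of the maximum wins strictly in two rows, these alone give `b ^ 2`.
Otherwise at most one row loses powers of `μ`, and it loses at most `t + 1` of the total `2 * t`. -/
theorem prod_max_le (S : Finset V) (M ℓ : V → ℕ) (t : ℕ) {μ b : ℝ} (hμ : 0 ≤ μ) (hμ1 : μ ≤ 1)
    (hb : 0 ≤ b) (hb1 : b ≤ 1) (hℓ : ∀ u, ℓ u ≤ M u) (hM : ∀ u, M u ≤ ℓ u + (t + 1))
    (hsum : ∑ u ∈ S, M u = 2 * t) :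
    ∏ u ∈ S, max (μ ^ M u) (b * μ ^ ℓ u) ≤ max (b ^ 2) (μ ^ (t - 1)) := by
  have h0 : ∀ u, 0 ≤ max (μ ^ M u) (b * μ ^ ℓ u) := fun u => le_max_of_le_left (by positivity)
  have h1 : ∀ u, max (μ ^ M u) (b * μ ^ ℓ u) ≤ 1 := fun u =>
    max_le (pow_le_one₀ hμ hμ1) (mul_le_one₀ hb1 (by positivity) (pow_le_one₀ hμ hμ1))
  rcases S.eq_empty_or_nonempty with rfl | ⟨u₀, hu₀⟩
  · have : t = 0 := by simpa using hsum.symm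
    simp [this]
  by_cases h : ∃ a, ∀ u ∈ S, u ≠ a → max (μ ^ M u) (b * μ ^ ℓ u) ≤ μ ^ M u
  · obtain ⟨a, ha⟩ := h
    refine le_max_of_le_right ?_
    calc _ ≤ ∏ u ∈ S, μ ^ (if u = a then ℓ u else M u) := by
          refine Finset.prod_le_prod (fun u _ => h0 u) fun u hu => ?_
          split_ifs with hua
          · refine max_le (pow_le_pow_of_le_one hμ hμ1 (hℓ u)) ?_
            exact mul_le_of_le_one_left (by positivity) hb1
          · exact ha u hu hua
      _ = μ ^ (∑ u ∈ S, if u = a then ℓ u else M u) := Finset.prod_pow_eq_pow_sum _ _ _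
      _ ≤ μ ^ (t - 1) := by
        refine pow_le_pow_of_le_one hμ hμ1 ?_
        have : ∑ u ∈ S, M u ≤ ∑ u ∈ S, ((if u = a then ℓ u else M u) + if u = a then t + 1 else 0) := by
          refine Finset.sum_le_sum fun u _ => ?_
          split_ifs
          · exact hM u
          · simp
        rw [Finset.sum_add_distrib, Finset.sum_ite_eq'] at this
        split_ifs at this <;> omega
  · push Not at h
    obtain ⟨u₁, hu₁, -, h₁⟩ := h u₀
    obtain ⟨u₂, hu₂, hne, h₂⟩ := h u₁
    have key : ∀ u, μ ^ M u < max (μ ^ M u) (b * μ ^ ℓ u) → max (μ ^ M u) (b * μ ^ ℓ u) ≤ b := by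
      intro u hu
      have : μ ^ M u < b * μ ^ ℓ u := by simpa using hu
      rw [max_eq_right this.le]
      exact mul_le_of_le_one_right hb (pow_le_one₀ hμ hμ1)
    refine le_max_of_le_left ?_
    rw [← Finset.mul_prod_erase S _ hu₁,
      ← Finset.mul_prod_erase (S.erase u₁) _ (Finset.mem_erase.2 ⟨hne, hu₂⟩), ← mul_assoc, sq]
    refine (mul_le_of_le_one_right (mul_nonneg (h0 _) (h0 _))
      (Finset.prod_le_one (fun u _ => h0 u) fun u _ => h1 u)).trans ?_
    exact mul_le_mul (key _ h₁) (key _ h₂) (h0 _) hb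

theorem mult_le_loops_add (x y u : V) {t : ℕ} {l l' : List V} (hl : l.length = t)
    (hl' : l'.length = t) :
    ∑ z, (walkEdges x l ++ walkEdges y l').count (u, z) ≤
      (walkEdges x l ++ walkEdges y l').count (u, u) + (t + 1) := by
  rw [← Finset.add_sum_erase _ _ (Finset.mem_univ u), sum_count_row, List.countP_append]
  have h1 := two_mul_nonloop_le u x l
  have h2 := two_mul_nonloop_le u y l'
  split_ifs at h1 h2 <;> omega

end Patterns

/-! ### Moments of a single centred row. -/

section Rows

variable {V : Type*} [Fintype V]

/-- The law of a row of independent Bernoulli variables. -/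
abbrev rowLaw (p : V → unitInterval) : Measure (V → Bool) :=
  Measure.pi fun y => ProbabilityTheory.bernoulliMeasure true false (p y)

theorem integral_rowLaw_prod (p : V → unitInterval) (f : V → Bool → ℝ) :
    ∫ g, ∏ y, f y (g y) ∂(rowLaw p) =
      ∏ y, ((p y : ℝ) * f y true + (1 - (p y : ℝ)) * f y false) := by
  rw [integral_fintype_prod_eq_prod]
  simp [ProbabilityTheory.integral_bernoulliMeasure]

theorem integrable_rowLaw (p : V → unitInterval) (f : (V → Bool) → ℝ) :
    Integrable f (rowLaw p) := Integrable.of_finite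

/-- The number of successes in a row. -/
def successes (g : V → Bool) : ℕ := (Finset.univ.filter fun y => g y = true).card

theorem successes_eq_sum (g : V → Bool) :
    (successes g : ℝ) = ∑ y, if g y = true then (1 : ℝ) else 0 := by
  simp [successes]

theorem successes_pos {g : V → Bool} {z : V} (hz : g z = true) : 0 < successes g :=
  Finset.card_pos.2 ⟨z, by simpa using hz⟩

/-- The row of the centred transition matrix: the walk step minus `v`, or zero if the row of the
transition matrix vanishes. -/
def centredRow (v : V → ℝ) (z : V) (g : V → Bool) : ℝ :=
  if successes g = 0 then 0 else (if g z = true then 1 / (successes g : ℝ) else 0) - v z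

theorem abs_centredRow_le {v : V → ℝ} (hv : ∀ z, 0 ≤ v z) (z : V) (g : V → Bool) {b : ℝ}
    (hb : 0 ≤ b) (h : successes g ≠ 0 → 1 / (successes g : ℝ) ≤ b) :
    |centredRow v z g| ≤ (if g z = true then b else 0) + v z := by
  have := hv z
  rw [centredRow]
  split_ifs with h1 h2
  · simp; linarith
  · simp; linarith
  · have h3 := h h1
    have : (0 : ℝ) ≤ 1 / (successes g : ℝ) := by positivity
    rw [abs_le]; constructor <;> linarith
  · simp [abs_of_nonneg, this]

/-- The first term covers `Λ ≤ successes g`. Otherwise `exp (a * (Λ - successes g))` is at least 1;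
dropping the coordinates in the support of `m` from its exponent only increases it and leaves a
product over independent coordinates. -/
theorem abs_prod_centredRow_le {v : V → ℝ} (hv : ∀ z, 0 ≤ v z) (m : V → ℕ) {Λ a : ℝ}
    (hΛ : 1 ≤ Λ) (ha : 0 ≤ a) (g : V → Bool) :
    |∏ z, centredRow v z g ^ m z| ≤
      ∏ z, ((if g z = true then Λ⁻¹ else 0) + v z) ^ m z +
      Real.exp (a * Λ) * ∏ z, (if m z = 0 then Real.exp (-a * (if g z = true then 1 else 0))
        else ((if g z = true then 1 else 0) + v z) ^ m z) := by
  have hΛ0 : 0 < Λ := by linarith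
  have hA : 0 ≤ ∏ z, ((if g z = true then Λ⁻¹ else 0) + v z) ^ m z := by
    refine Finset.prod_nonneg fun z _ => pow_nonneg (add_nonneg ?_ (hv z)) _
    split_ifs <;> positivity
  have hB : 0 ≤ Real.exp (a * Λ) * ∏ z, (if m z = 0 then
      Real.exp (-a * (if g z = true then 1 else 0))
        else ((if g z = true then 1 else 0) + v z) ^ m z) := by
    refine mul_nonneg (Real.exp_pos _).le (Finset.prod_nonneg fun z _ => ?_)
    split_ifs
    any_goals positivity
    · exact pow_nonneg (add_nonneg zero_le_one (hv z)) _
    · exact pow_nonneg (add_nonneg le_rfl (hv z)) _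
  rw [Finset.abs_prod]
  by_cases h : Λ ≤ successes g
  · refine le_trans ?_ (le_add_of_nonneg_right hB)
    refine Finset.prod_le_prod (fun z _ => abs_nonneg _) fun z _ => ?_
    rw [abs_pow]
    refine pow_le_pow_left₀ (abs_nonneg _) (abs_centredRow_le hv z g (by positivity) fun _ => ?_) _
    rw [one_div]
    exact inv_anti₀ hΛ0 h
  · refine le_trans ?_ (le_add_of_nonneg_left hA)
    push Not at h
    have h1 : (∏ z, (if m z = 0 then (1 : ℝ) else ((if g z = true then 1 else 0) + v z) ^ m z)) ≤
        Real.exp (a * Λ) * ∏ z, (if m z = 0 then Real.exp (-a * (if g z = true then 1 else 0))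
        else ((if g z = true then 1 else 0) + v z) ^ m z) := by
      have h2 : ∏ z, (Real.exp (-a * (if g z = true then 1 else 0)) *
          (if m z = 0 then (1 : ℝ) else ((if g z = true then 1 else 0) + v z) ^ m z)) ≤
          ∏ z, (if m z = 0 then Real.exp (-a * (if g z = true then 1 else 0))
        else ((if g z = true then 1 else 0) + v z) ^ m z) := by
        refine Finset.prod_le_prod (fun z _ => ?_) fun z _ => ?_
        · refine mul_nonneg (Real.exp_pos _).le ?_
          split_ifs
          any_goals positivity
          · exact pow_nonneg (add_nonneg zero_le_one (hv z)) _
          · exact pow_nonneg (add_nonneg le_rfl (hv z)) _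
        · by_cases hm : m z = 0
          · simp [hm]
          · simp only [hm, if_false]
            refine mul_le_of_le_one_left (pow_nonneg (add_nonneg ?_ (hv z)) _) ?_
            · split_ifs <;> simp
            · rw [Real.exp_le_one_iff]
              split_ifs <;> simp [ha]
      rw [Finset.prod_mul_distrib, ← Real.exp_sum, ← Finset.mul_sum, ← successes_eq_sum] at h2
      refine le_trans ?_ (mul_le_mul_of_nonneg_left h2 (Real.exp_pos _).le)
      rw [← mul_assoc, ← Real.exp_add]
      refine le_mul_of_one_le_left (Finset.prod_nonneg fun z _ => ?_) ?_
      · split_ifs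
        any_goals positivity
        · exact pow_nonneg (add_nonneg zero_le_one (hv z)) _
        · exact pow_nonneg (add_nonneg le_rfl (hv z)) _
      · rw [Real.one_le_exp_iff]
        nlinarith
    refine le_trans (Finset.prod_le_prod (fun z _ => abs_nonneg _) fun z _ => ?_) h1
    by_cases hm : m z = 0
    · simp [hm]
    · rw [if_neg hm, abs_pow]
      refine pow_le_pow_left₀ (abs_nonneg _) (abs_centredRow_le hv z g zero_le_one fun h0 => ?_) _
      rw [div_le_one (by positivity)]
      exact_mod_cast Nat.one_le_iff_ne_zero.2 h0

/-- Used with `b = Λ⁻¹` for large out-degree and `b = 1` for small out-degree, so that both regimes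
share the same edge weight. -/
theorem bernoulli_pow_le {p v Λ : ℝ} (hp : 0 ≤ p) (hv : 0 ≤ v) (hΛ : 1 ≤ Λ)
    (hvΛ : v ≤ Λ⁻¹) {b : ℝ} (hbΛ : Λ⁻¹ ≤ b) {m : ℕ} (hm : m ≠ 0) :
    p * (b + v) ^ m + (1 - p) * (0 + v) ^ m ≤ 2 ^ m * ((p * Λ⁻¹ + v) * Λ) * b ^ m := by
  have hΛ0 : 0 < Λ := by linarith
  have hb : 0 < b := lt_of_lt_of_le (by positivity) hbΛ
  have h1 : (b + v) ^ m ≤ 2 ^ m * b ^ m := by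
    rw [← mul_pow]; exact pow_le_pow_left₀ (by positivity) (by linarith) _
  have h2 : v ^ m ≤ 2 ^ m * (v * Λ) * b ^ m := by
    obtain ⟨k, rfl⟩ := Nat.exists_eq_succ_of_ne_zero hm
    have h3 : v ^ k ≤ b ^ k := pow_le_pow_left₀ hv (hvΛ.trans hbΛ) _
    have h4 : 1 ≤ Λ * b := by
      calc (1 : ℝ) = Λ * Λ⁻¹ := by field_simp
        _ ≤ _ := by gcongr
    have h5 : (1 : ℝ) ≤ 2 ^ (k + 1) := one_le_pow₀ (by norm_num)
    calc v ^ (k + 1) = 1 * (v * v ^ k) * 1 := by ring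
      _ ≤ 2 ^ (k + 1) * (v * b ^ k) * (Λ * b) := by gcongr
      _ = _ := by simp only [Nat.succ_eq_add_one]; ring
  have h6 : (1 - p) * (0 + v) ^ m ≤ v ^ m := by
    rw [zero_add]; exact mul_le_of_le_one_left (by positivity) (by linarith)
  calc _ ≤ p * (2 ^ m * b ^ m) + 2 ^ m * (v * Λ) * b ^ m := by
        have := mul_le_mul_of_nonneg_left h1 hp
        linarith
    _ = _ := by field_simp

theorem bernoulli_exp_le (p a : ℝ) :
    p * Real.exp (-a * 1) + (1 - p) * Real.exp (-a * 0) ≤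
      Real.exp (-(1 - Real.exp (-a)) * p) := by
  have := Real.add_one_le_exp (-(1 - Real.exp (-a)) * p)
  simp only [mul_one, mul_zero, Real.exp_zero]
  linarith

variable [DecidableEq V]

/-- The weights that dominate the moments of the entries of the centred row at `x`. -/
def stepWeight (p v : V → ℝ) (Λ : ℝ) (x z : V) : ℝ :=
  if z = x then v x * Λ else p z * Λ⁻¹ + v z

/-- Both terms of `abs_prod_centredRow_le` factor over coordinates. In the rare regime the only
surviving powers of `Λ⁻¹` come from the loop entry: `x` is almost surely not its own out-neighbour,
so that entry is 0 or `-v x` whatever the out-degree. -/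
theorem abs_integral_prod_centredRow_le (p : V → unitInterval) {v : V → ℝ} (hv : ∀ z, 0 ≤ v z)
    (x : V) (hpx : p x = 0) (m : V → ℕ) {Λ a β : ℝ} (hΛ : 1 ≤ Λ) (ha : 0 ≤ a)
    (hvΛ : ∀ z, v z ≤ Λ⁻¹)
    (hβ : Real.exp (a * Λ - (1 - Real.exp (-a)) * ∑ y ∈ (rowSupport m)ᶜ, (p y : ℝ)) ≤ β) :
    |∫ g, ∏ z, centredRow v z g ^ m z ∂(rowLaw p)| ≤
      2 ^ (∑ z, m z) * (∏ z ∈ rowSupport m, stepWeight (fun y => p y) v Λ x z) *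
        Λ ^ (rowSupport m).card * (Λ⁻¹ ^ (∑ z, m z) + β * Λ⁻¹ ^ m x) := by
  have hΛ0 : 0 < Λ := by linarith
  have hΛ1 : Λ⁻¹ ≤ 1 := inv_le_one_of_one_le₀ hΛ
  have hp0 : ∀ y, (0 : ℝ) ≤ p y := fun y => (p y).2.1
  have hp1 : ∀ y, (p y : ℝ) ≤ 1 := fun y => (p y).2.2
  have hsw : ∀ z, 0 ≤ stepWeight (fun y => (p y : ℝ)) v Λ x z := by
    intro z
    have := hv z
    have := hv x
    have := hp0 z
    rw [stepWeight]; split_ifs <;> positivity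
  have hdiag : ∀ k : ℕ, k ≠ 0 → v x ^ k ≤ 2 ^ k * (v x * Λ * Λ) * Λ⁻¹ ^ k := by
    intro k hk
    have := bernoulli_pow_le (p := 0) le_rfl (hv x) hΛ (hvΛ x) le_rfl hk
    simp only [zero_mul, zero_add, sub_zero, one_mul] at this
    refine this.trans ?_
    have := hv x
    have h : v x * Λ ≤ v x * Λ * Λ := le_mul_of_one_le_right (by positivity) hΛ
    gcongr
  have hA : ∀ z, (p z : ℝ) * (Λ⁻¹ + v z) ^ m z + (1 - (p z : ℝ)) * (0 + v z) ^ m z ≤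
      if m z = 0 then 1 else 2 ^ m z * (stepWeight (fun y => p y) v Λ x z * Λ) * Λ⁻¹ ^ m z := by
    intro z
    split_ifs with hm
    · simp [hm]
    · by_cases hz : z = x
      · subst hz
        simpa [hpx, stepWeight] using hdiag _ hm
      · rw [stepWeight, if_neg hz]
        exact bernoulli_pow_le (hp0 z) (hv z) hΛ (hvΛ z) le_rfl hm
  have hB : ∀ z, ((p z : ℝ) * (if m z = 0 then Real.exp (-a * 1) else (1 + v z) ^ m z) +
        (1 - (p z : ℝ)) * (if m z = 0 then Real.exp (-a * 0) else (0 + v z) ^ m z)) ≤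
      if m z = 0 then Real.exp (-(1 - Real.exp (-a)) * p z) else
        2 ^ m z * (stepWeight (fun y => p y) v Λ x z * Λ) * (if z = x then Λ⁻¹ ^ m z else 1) := by
    intro z
    by_cases hm : m z = 0
    · simp only [hm, if_true]
      exact bernoulli_exp_le _ _
    · simp only [hm, if_false]
      by_cases hz : z = x
      · subst hz
        simpa [hpx, stepWeight] using hdiag _ hm
      · rw [stepWeight, if_neg hz, if_neg hz]
        simpa using bernoulli_pow_le (hp0 z) (hv z) hΛ (hvΛ z) hΛ1 hm
  have hpow : ∏ z ∈ rowSupport m, (2 : ℝ) ^ m z = 2 ^ ∑ z, m z := by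
    rw [Finset.prod_pow_eq_pow_sum]
    congr 1
    refine Finset.sum_subset (Finset.subset_univ _) fun z _ hz => ?_
    simpa [rowSupport] using hz
  have hpow' : ∏ z ∈ rowSupport m, Λ⁻¹ ^ m z = Λ⁻¹ ^ ∑ z, m z := by
    rw [Finset.prod_pow_eq_pow_sum]
    congr 1
    refine Finset.sum_subset (Finset.subset_univ _) fun z _ hz => ?_
    simpa [rowSupport] using hz
  have hsplit : ∀ f h : V → ℝ, ∏ z, (if m z = 0 then f z else h z) =
      (∏ z ∈ (rowSupport m)ᶜ, f z) * ∏ z ∈ rowSupport m, h z := by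
    intro f h
    rw [Finset.prod_ite]
    congr 2
    ext z; simp [rowSupport]
  have h1 : ∫ g, ∏ z, ((if g z = true then Λ⁻¹ else 0) + v z) ^ m z ∂(rowLaw p) ≤
      2 ^ (∑ z, m z) * (∏ z ∈ rowSupport m, stepWeight (fun y => p y) v Λ x z) *
        Λ ^ (rowSupport m).card * Λ⁻¹ ^ (∑ z, m z) := by
    rw [integral_rowLaw_prod p (fun z b => ((if b = true then Λ⁻¹ else 0) + v z) ^ m z)]
    simp only [if_true, Bool.false_eq_true, if_false]
    refine (Finset.prod_le_prod (fun z _ => ?_) fun z _ => hA z).trans (le_of_eq ?_)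
    · have := hp0 z
      have := hp1 z
      have := hv z
      have : 0 ≤ 1 - (p z : ℝ) := by linarith
      positivity
    · rw [hsplit, Finset.prod_const_one, one_mul, Finset.prod_mul_distrib, Finset.prod_mul_distrib,
        Finset.prod_mul_distrib, hpow, hpow', Finset.prod_const]
      ring
  have h2 : Real.exp (a * Λ) * ∫ g, ∏ z, (if m z = 0 then
        Real.exp (-a * (if g z = true then 1 else 0))
        else ((if g z = true then 1 else 0) + v z) ^ m z) ∂(rowLaw p) ≤
      2 ^ (∑ z, m z) * (∏ z ∈ rowSupport m, stepWeight (fun y => p y) v Λ x z) *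
        Λ ^ (rowSupport m).card * (β * Λ⁻¹ ^ m x) := by
    rw [integral_rowLaw_prod p (fun z b => if m z = 0 then
        Real.exp (-a * (if b = true then 1 else 0))
        else ((if b = true then 1 else 0) + v z) ^ m z)]
    simp only [if_true, Bool.false_eq_true, if_false]
    have h3 := Finset.prod_le_prod (s := Finset.univ) (fun z _ => ?_) fun z _ => hB z
    · refine (mul_le_mul_of_nonneg_left h3 (Real.exp_pos _).le).trans ?_
      rw [hsplit, ← Real.exp_sum, ← Finset.mul_sum, Finset.prod_mul_distrib,
        Finset.prod_mul_distrib, Finset.prod_mul_distrib, hpow, Finset.prod_const, ← mul_assoc,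
        ← Real.exp_add]
      have h4 : ∏ z ∈ rowSupport m, (if z = x then Λ⁻¹ ^ m z else 1) = Λ⁻¹ ^ m x := by
        rw [Finset.prod_ite_eq']
        split_ifs with hx
        · rfl
        · have : m x = 0 := by simpa [rowSupport] using hx
          simp [this]
      rw [h4]
      have h5 : 0 ≤ ∏ z ∈ rowSupport m, stepWeight (fun y => (p y : ℝ)) v Λ x z :=
        Finset.prod_nonneg fun z _ => hsw z
      calc _ ≤ β * (2 ^ (∑ z, m z) * ((∏ z ∈ rowSupport m, stepWeight (fun y => p y) v Λ x z) *
            Λ ^ (rowSupport m).card) * Λ⁻¹ ^ m x) := by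
            refine mul_le_mul_of_nonneg_right (le_trans (le_of_eq ?_) hβ) (by positivity)
            congr 1; ring
        _ = _ := by ring
    · have := hp0 z
      have := hp1 z
      have := hv z
      have : 0 ≤ 1 - (p z : ℝ) := by linarith
      split_ifs <;> positivity
  calc _ ≤ ∫ g, |∏ z, centredRow v z g ^ m z| ∂(rowLaw p) := abs_integral_le_integral_abs
    _ ≤ ∫ g, (∏ z, ((if g z = true then Λ⁻¹ else 0) + v z) ^ m z +
      Real.exp (a * Λ) * ∏ z, (if m z = 0 then Real.exp (-a * (if g z = true then 1 else 0))
        else ((if g z = true then 1 else 0) + v z) ^ m z)) ∂(rowLaw p) :=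
        integral_mono (integrable_rowLaw _ _) (integrable_rowLaw _ _)
          fun g => abs_prod_centredRow_le hv m hΛ ha g
    _ ≤ _ := by
      rw [integral_add (integrable_rowLaw _ _) (integrable_rowLaw _ _), integral_const_mul]
      linarith

/-- Switching coordinate `z` off is a bijection that multiplies the probability by `(1 - p z) / p
z`. -/
theorem integral_rowLaw_flip (p : V → unitInterval) (f : (V → Bool) → ℝ) (z : V) :
    (1 - (p z : ℝ)) * ∫ g, (if g z = true then f g else 0) ∂(rowLaw p) =
      p z * ∫ g, (if g z = true then 0 else f (Function.update g z true)) ∂(rowLaw p) := by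
  have hsum : ∀ h : (V → Bool) → ℝ, ∫ g, h g ∂(rowLaw p) =
      ∑ g, (∏ y, if g y = true then (p y : ℝ) else 1 - p y) * h g := by
    intro h
    have h1 : h = fun g => ∑ g', h g' * ∏ y, if g y = g' y then (1 : ℝ) else 0 := by
      funext g
      rw [Finset.sum_eq_single g]
      · simp
      · intro b _ hb
        obtain ⟨y, hy⟩ := Function.ne_iff.1 hb
        rw [Finset.prod_eq_zero (Finset.mem_univ y) (by simp [Ne.symm hy]), mul_zero]
      · simp
    conv_lhs => rw [h1]
    rw [integral_finsetSum _ fun i _ => integrable_rowLaw _ _]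
    refine Finset.sum_congr rfl fun g' _ => ?_
    rw [integral_const_mul, integral_rowLaw_prod p (fun y b => if b = g' y then (1 : ℝ) else 0),
      mul_comm]
    congr 1
    refine Finset.prod_congr rfl fun y _ => ?_
    cases g' y <;> simp
  rw [hsum, hsum, Finset.mul_sum, Finset.mul_sum]
  simp only [mul_ite, mul_zero]
  rw [Finset.sum_ite, Finset.sum_ite, Finset.sum_const_zero, Finset.sum_const_zero, add_zero,
    zero_add]
  refine Finset.sum_nbij' (fun g => Function.update g z false) (fun g => Function.update g z true)
    (by simp) (by simp) ?_ ?_ ?_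
  · intro g hg
    have : g z = true := by simpa using hg
    simp [← this]
  · intro g hg
    have : g z = false := by simpa using hg
    simp [← this]
  · intro g hg
    have hgz : g z = true := by simpa using hg
    have h1 : Function.update (Function.update g z false) z true = g := by simp [← hgz]
    rw [h1, ← Finset.mul_prod_erase Finset.univ _ (Finset.mem_univ z),
      ← Finset.mul_prod_erase Finset.univ (fun y => if Function.update g z false y = true then _
        else _) (Finset.mem_univ z)]
    have h2 : ∏ y ∈ Finset.univ.erase z, (if Function.update g z false y = true then (p y : ℝ)
        else 1 - p y) = ∏ y ∈ Finset.univ.erase z, if g y = true then (p y : ℝ) else 1 - p y := by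
      refine Finset.prod_congr rfl fun y hy => ?_
      rw [Function.update_of_ne (Finset.ne_of_mem_erase hy)]
    rw [h2]
    simp only [hgz, if_true, Function.update_self, Bool.false_eq_true, if_false]
    ring

theorem successes_update (g : V → Bool) {z : V} (hz : g z = false) :
    successes (Function.update g z true) = successes g + 1 := by
  rw [successes, successes, ← Finset.card_insert_of_notMem (a := z) (by simp [hz])]
  congr 1
  ext y
  by_cases hy : y = z <;> simp [hy]

/-- With D the out-degree, flipping an edge places the mean transition probability to z between `p z
* a` and `p z * a / (1 - p z)`, where a = E[1/(D+1)] does not depend on z. These means sum to `r`,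
the probability that D is nonzero, which pins a down; since `p` is proportional to `v` off `x`, they
are nearly `v z`. -/
theorem abs_integral_centredRow_le (p : V → unitInterval) {v : V → ℝ} (hv : ∀ z, 0 ≤ v z)
    (hv1 : ∑ z, v z = 1) {x : V} (hpx : p x = 0) {κ P : ℝ} (hκ : 0 < κ)
    (hp : ∀ y, y ≠ x → (p y : ℝ) = κ * v y) (hpP : ∀ y, (p y : ℝ) ≤ P) (hP : P ≤ 1 / 4)
    (hvx : v x ≤ 1 / 4) {z : V} (hz : z ≠ x) :
    |∫ g, centredRow v z g ∂(rowLaw p)| ≤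
      v z * (2 * v x + 2 * P + Real.exp (-∑ y, (p y : ℝ))) := by
  have hp0 : ∀ y, (0 : ℝ) ≤ p y := fun y => (p y).2.1
  set T : V → ℝ := fun y => ∫ g, (if g y = true then 1 / (successes g : ℝ) else 0) ∂(rowLaw p)
    with hT
  set a : ℝ := ∫ g, 1 / ((successes g : ℝ) + 1) ∂(rowLaw p) with ha
  set r : ℝ := ∫ g, (if successes g = 0 then 0 else 1) ∂(rowLaw p) with hr
  have hr1 : 1 - r ≤ Real.exp (-∑ y, (p y : ℝ)) := by
    have h1 : 1 - r = ∫ g, ∏ y, (if g y = true then (0 : ℝ) else 1) ∂(rowLaw p) := by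
      have : (1 : ℝ) = ∫ _, 1 ∂(rowLaw p) := by simp
      rw [hr]
      nth_rewrite 1 [this]
      rw [← integral_sub (integrable_rowLaw _ _) (integrable_rowLaw _ _)]
      refine integral_congr_ae (Filter.Eventually.of_forall fun g => ?_)
      simp only
      by_cases hg : successes g = 0
      · have : ∀ y, g y = false := by simpa [successes, Finset.filter_eq_empty_iff] using hg
        simp [hg, this]
      · obtain ⟨y, hy⟩ := Finset.card_pos.1 (Nat.pos_of_ne_zero hg)
        rw [Finset.prod_eq_zero (Finset.mem_univ y) (by simpa using hy)]
        simp [hg]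
    rw [h1, integral_rowLaw_prod p (fun _ b => if b = true then (0 : ℝ) else 1),
      ← Finset.sum_neg_distrib, Real.exp_sum]
    refine Finset.prod_le_prod (fun y _ => ?_) fun y _ => ?_
    · have := (p y).2.2
      simp; linarith
    · have := Real.add_one_le_exp (-(p y : ℝ))
      simp; linarith
  have hr2 : r ≤ 1 := by
    have : (1 : ℝ) = ∫ _, 1 ∂(rowLaw p) := by simp
    rw [this]
    refine integral_mono (integrable_rowLaw _ _) (integrable_rowLaw _ _) fun g => ?_
    simp only; split_ifs <;> norm_num
  have hr0 : 0 ≤ r := integral_nonneg fun g => by simp only; split_ifs <;> simp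
  have hT0 : ∀ y, 0 ≤ T y := fun y => integral_nonneg fun g => by
    simp only; split_ifs <;> positivity
  have ha0 : 0 ≤ a := integral_nonneg fun g => by positivity
  have hflip : ∀ y, (1 - (p y : ℝ)) * T y =
      p y * ∫ g, (if g y = true then 0 else 1 / ((successes g : ℝ) + 1)) ∂(rowLaw p) := by
    intro y
    rw [hT, integral_rowLaw_flip]
    congr 2
    funext g
    split_ifs with h
    · rfl
    · rw [successes_update g (by simpa using h)]; push_cast; rfl
  have hup : ∀ y, (1 - (p y : ℝ)) * T y ≤ p y * a := by
    intro y
    rw [hflip]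
    refine mul_le_mul_of_nonneg_left ?_ (hp0 y)
    refine integral_mono (integrable_rowLaw _ _) (integrable_rowLaw _ _) fun g => ?_
    simp only; split_ifs
    · positivity
    · rfl
  have hlo : ∀ y, p y * a ≤ T y := by
    intro y
    have h1 : a ≤ (∫ g, (if g y = true then 0 else 1 / ((successes g : ℝ) + 1)) ∂(rowLaw p)) + T y := by
      rw [hT, ← integral_add (integrable_rowLaw _ _) (integrable_rowLaw _ _)]
      refine integral_mono (integrable_rowLaw _ _) (integrable_rowLaw _ _) fun g => ?_
      simp only; split_ifs with h
      · have : (0 : ℝ) < successes g := by exact_mod_cast successes_pos h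
        rw [zero_add]
        exact one_div_le_one_div_of_le this (by linarith)
      · simp
    have h2 := hflip y
    have h3 := mul_le_mul_of_nonneg_left h1 (hp0 y)
    linarith
  have hsumT : ∑ y, T y = r := by
    rw [hT, ← integral_finsetSum _ fun i _ => integrable_rowLaw _ _, hr]
    refine integral_congr_ae (Filter.Eventually.of_forall fun g => ?_)
    simp only
    rw [← Finset.sum_filter, Finset.sum_const, nsmul_eq_mul]
    by_cases hg : successes g = 0
    · simp [hg]
    · rw [if_neg hg, mul_one_div]
      exact div_self (by exact_mod_cast hg)
  have hint : ∫ g, centredRow v z g ∂(rowLaw p) = T z - v z * r := by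
    rw [hT, hr, ← integral_const_mul,
      ← integral_sub (integrable_rowLaw _ _) (integrable_rowLaw _ _)]
    refine integral_congr_ae (Filter.Eventually.of_forall fun g => ?_)
    simp only [centredRow]
    by_cases hg : successes g = 0
    · have : g z = false := by
        by_contra h
        exact (successes_pos (by simpa using h : g z = true)).ne' hg
      simp [hg, this]
    · simp [hg]
  set s : ℝ := ∑ y, (p y : ℝ) with hs
  have hs' : s = κ * (1 - v x) := by
    rw [hs, ← Finset.add_sum_erase _ _ (Finset.mem_univ x), ← hv1,
      ← Finset.add_sum_erase _ v (Finset.mem_univ x), hpx]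
    rw [add_sub_cancel_left, Finset.mul_sum]
    simp only [Set.Icc.coe_zero, zero_add]
    exact Finset.sum_congr rfl fun y hy => hp y (Finset.ne_of_mem_erase hy)
  have hvx0 := hv x
  have hvz0 := hv z
  have hP0 : 0 ≤ P := (hp0 x).trans (hpP x)
  have hlo' : s * a ≤ r := by
    rw [hs, Finset.sum_mul, ← hsumT]
    exact Finset.sum_le_sum fun y _ => hlo y
  have hup' : (1 - P) * r ≤ s * a := by
    rw [hs, Finset.sum_mul, ← hsumT, Finset.mul_sum]
    refine Finset.sum_le_sum fun y _ => le_trans ?_ (hup y)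
    exact mul_le_mul_of_nonneg_right (by linarith [hpP y]) (hT0 y)
  rw [hs'] at hlo' hup'
  have hlz := hlo z
  have huz : (1 - P) * T z ≤ p z * a :=
    le_trans (mul_le_mul_of_nonneg_right (by linarith [hpP z]) (hT0 z)) (hup z)
  rw [hp z hz] at hlz huz
  have hκa : (1 - v x) * (κ * a) ≤ 1 := by linarith
  have hκa' : (1 - P) * r ≤ κ * a := by
    have : κ * (1 - v x) * a ≤ κ * a := by
      have : 0 ≤ κ * a := by positivity
      nlinarith
    linarith
  have hTup : T z ≤ v z * (1 + 2 * (v x + P)) := by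
    have h1 : κ * a ≤ (1 - P) * (1 + 2 * (v x + P)) := by
      have h2 : 1 ≤ (1 - v x) * ((1 - P) * (1 + 2 * (v x + P))) := by
        have hw : 0 ≤ (v x + P) * (1 - 2 * (v x + P)) := mul_nonneg (by linarith) (by linarith)
        have hw' : 0 ≤ v x * P * (1 + 2 * (v x + P)) := by positivity
        linear_combination hw + hw'
      have h3 : (1 - v x) * (κ * a) ≤ (1 - v x) * ((1 - P) * (1 + 2 * (v x + P))) := hκa.trans h2
      exact le_of_mul_le_mul_left h3 (by linarith)
    have h4 : (1 - P) * T z ≤ (1 - P) * (v z * (1 + 2 * (v x + P))) := by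
      calc _ ≤ κ * v z * a := huz
        _ = v z * (κ * a) := by ring
        _ ≤ v z * ((1 - P) * (1 + 2 * (v x + P))) := by gcongr
        _ = _ := by ring
    exact le_of_mul_le_mul_left h4 (by linarith)
  have hTlo : v z * ((1 - P) * r) ≤ T z := by
    calc v z * ((1 - P) * r) ≤ v z * (κ * a) := by gcongr
      _ = κ * v z * a := by ring
      _ ≤ _ := hlz
  have hexp : 0 < Real.exp (-s) := Real.exp_pos _
  rw [hint, abs_le]
  constructor
  · have h1 : v z * (P * r) ≤ v z * (2 * v x + 2 * P + Real.exp (-s)) := by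
      gcongr; nlinarith
    nlinarith
  · have h1 : v z * (1 - r) ≤ v z * Real.exp (-s) := by gcongr
    nlinarith

theorem abs_integral_centredRow_diag_le (p : V → unitInterval) {v : V → ℝ} (hv : ∀ z, 0 ≤ v z)
    {x : V} (hpx : p x = 0) : |∫ g, centredRow v x g ∂(rowLaw p)| ≤ v x := by
  have h := integral_rowLaw_flip p (fun g => 1 / (successes g : ℝ)) x
  simp only [hpx, Set.Icc.coe_zero, sub_zero, one_mul, zero_mul] at h
  have h1 : ∫ g, centredRow v x g ∂(rowLaw p) =
      ∫ g, (centredRow v x g - if g x = true then 1 / (successes g : ℝ) else 0) ∂(rowLaw p) := by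
    rw [integral_sub (integrable_rowLaw _ _) (integrable_rowLaw _ _), h, sub_zero]
  rw [h1]
  refine abs_integral_le_integral_abs.trans ?_
  have : v x = ∫ _, v x ∂(rowLaw p) := by simp
  rw [this]
  refine integral_mono (integrable_rowLaw _ _) (integrable_rowLaw _ _) fun g => ?_
  simp only [centredRow]
  have := hv x
  split_ifs with h1 h2
  · exact absurd h1 (successes_pos h2).ne'
  · simpa using this
  · simp [abs_of_nonneg this]
  · simp [abs_of_nonneg this]

end Rows

/-! ### Moments of powers of the centred matrix. -/

section Moments

variable {V : Type*} [Fintype V]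

/-- The law of a matrix with independent Bernoulli entries. -/
abbrev matrixLaw (p : V → V → unitInterval) : Measure (V → V → Bool) :=
  Measure.pi fun x => rowLaw (p x)

/-- The centred transition matrix. -/
def centredMatrix (v : V → ℝ) (G : V → V → Bool) : Matrix V V ℝ :=
  Matrix.of fun x z => centredRow v z (G x)

theorem integrable_matrixLaw (p : V → V → unitInterval) (f : (V → V → Bool) → ℝ) :
    Integrable f (matrixLaw p) := Integrable.of_finite

variable [DecidableEq V]

/-- Quantitative assumptions on a family of edge probabilities under which the moments of walks of
length at most `t` are controlled. -/
structure Controlled (p : V → V → unitInterval) (v : V → ℝ) (t : ℕ) (Λ β K Q ε : ℝ) : Prop where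
  v_nonneg : ∀ z, 0 ≤ v z
  loopless : ∀ x, p x x = 0
  one_le : 1 ≤ Λ
  v_le : ∀ z, v z ≤ Λ⁻¹
  β_nonneg : 0 ≤ β
  β_le : β * Λ ≤ 1
  exp_le : ∃ a : ℝ, 0 ≤ a ∧ ∀ (x : V) (A : Finset V), A.card ≤ 2 * t →
    Real.exp (a * Λ - (1 - Real.exp (-a)) * ∑ y ∈ Aᶜ, (p x y : ℝ)) ≤ β
  K_nonneg : 0 ≤ K
  sum_le : ∀ x, ∑ z ∈ Finset.univ.erase x, stepWeight (fun y => (p x y : ℝ)) v Λ x z ≤ K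
  weight_le : ∀ x z, stepWeight (fun y => (p x y : ℝ)) v Λ x z ≤ Q
  ε_nonneg : 0 ≤ ε
  ε_le : ε ≤ Λ⁻¹
  mean_le : ∀ x z, z ≠ x → |∫ g, centredRow v z g ∂(rowLaw (p x))| ≤
    stepWeight (fun y => (p x y : ℝ)) v Λ x z * ε

namespace Controlled

variable {p : V → V → unitInterval} {v : V → ℝ} {t : ℕ} {Λ β K Q ε : ℝ}

theorem weight_nonneg (h : Controlled p v t Λ β K Q ε) (x z : V) :
    0 ≤ stepWeight (fun y => (p x y : ℝ)) v Λ x z := by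
  have h1 := h.v_nonneg z
  have h2 := h.v_nonneg x
  have h3 := h.one_le
  have h4 : (0 : ℝ) ≤ p x z := (p x z).2.1
  rw [stepWeight]; split_ifs <;> positivity

theorem mean_le_inv (h : Controlled p v t Λ β K Q ε) (x z : V) :
    |∫ g, centredRow v z g ∂(rowLaw (p x))| ≤
      stepWeight (fun y => (p x y : ℝ)) v Λ x z * Λ⁻¹ := by
  have hΛ : 0 < Λ := by linarith [h.one_le]
  by_cases hz : z = x
  · subst hz
    refine (abs_integral_centredRow_diag_le (p z) h.v_nonneg (h.loopless z)).trans (le_of_eq ?_)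
    rw [stepWeight, if_pos rfl]; field_simp
  · exact (h.mean_le x z hz).trans (mul_le_mul_of_nonneg_left h.ε_le (h.weight_nonneg x z))

theorem rowSupport_single {m : V → ℕ} {z : V} (hm : ∀ w, m w = if w = z then 1 else 0) :
    rowSupport m = {z} := by
  ext w; simp [rowSupport, hm]

theorem row_single_le (x : V) {m : V → ℕ} {z : V} (hm : ∀ w, m w = if w = z then 1 else 0)
    {c : ℝ} (hc : |∫ g, centredRow v z g ∂(rowLaw (p x))| ≤
      stepWeight (fun y => (p x y : ℝ)) v Λ x z * c) :
    |∫ g, ∏ z, centredRow v z g ^ m z ∂(rowLaw (p x))| ≤ 4 ^ (∑ z, m z) *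
      (∏ z ∈ rowSupport m, stepWeight (fun y => (p x y : ℝ)) v Λ x z) *
        Λ ^ ((rowSupport m).card - 1) * c := by
  have h1 : ∀ g, ∏ w, centredRow v w g ^ m w = centredRow v z g := by
    intro g
    rw [Finset.prod_eq_single z]
    · simp [hm]
    · intro w _ hw; simp [hm, hw]
    · simp
  have h0 := (abs_nonneg _).trans hc
  simp_rw [h1]
  rw [rowSupport_single hm]
  have h2 : ∑ w, m w = 1 := by simp [hm]
  simp only [h2, Finset.prod_singleton, Finset.card_singleton, pow_one, le_refl, tsub_eq_zero_of_le,
    pow_zero, mul_one]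
  linarith

/-- One factor `Λ` must be absorbed to reach the exponent `card - 1`. For total multiplicity M ≥ 2
this leaves `Λ ^ (1 - M)`, at most `√Λ⁻¹ ^ M`; for M = 1 the absolute moment is too weak and the
bound on the mean is used. -/
theorem row_le (h : Controlled p v t Λ β K Q ε) (x : V) {m : V → ℕ} (hm : ∑ z, m z ≠ 0)
    (hmt : ∑ z, m z ≤ 2 * t) :
    |∫ g, ∏ z, centredRow v z g ^ m z ∂(rowLaw (p x))| ≤ 4 ^ (∑ z, m z) *
      (∏ z ∈ rowSupport m, stepWeight (fun y => (p x y : ℝ)) v Λ x z) *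
        Λ ^ ((rowSupport m).card - 1) *
          max (√Λ⁻¹ ^ (∑ z, m z)) (β * Λ * √Λ⁻¹ ^ m x) := by
  have hΛ : 0 < Λ := by linarith [h.one_le]
  set μ := √Λ⁻¹ with hμ
  have hμ0 : 0 ≤ μ := Real.sqrt_nonneg _
  have hμ2 : μ ^ 2 = Λ⁻¹ := Real.sq_sqrt (by positivity)
  have hμ1 : μ ≤ 1 := Real.sqrt_le_one.2 (inv_le_one_of_one_le₀ h.one_le)
  have hW : 0 ≤ ∏ z ∈ rowSupport m, stepWeight (fun y => (p x y : ℝ)) v Λ x z :=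
    Finset.prod_nonneg fun z _ => h.weight_nonneg x z
  by_cases hm1 : ∑ z, m z = 1
  · obtain ⟨z, hz⟩ : ∃ z, m z ≠ 0 := by
      by_contra hcon
      push Not at hcon
      exact hm (Finset.sum_eq_zero fun z _ => hcon z)
    have hms : ∀ w, m w = if w = z then 1 else 0 := by
      have h1 := Finset.add_sum_erase Finset.univ m (Finset.mem_univ z)
      have h2 : ∑ w ∈ Finset.univ.erase z, m w = 0 := by omega
      intro w
      split_ifs with hw
      · subst hw; omega
      · exact Finset.sum_eq_zero_iff.1 h2 w (by simp [hw])
    refine (row_single_le x hms (h.mean_le_inv x z)).trans ?_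
    refine mul_le_mul_of_nonneg_left (le_max_of_le_left ?_) (by positivity)
    rw [hm1, ← hμ2, pow_one]
    nlinarith
  · obtain ⟨a, ha, hexp⟩ := h.exp_le
    have hcard : (rowSupport m).card ≤ ∑ z, m z := by
      rw [Finset.card_eq_sum_ones]
      calc _ ≤ ∑ z ∈ rowSupport m, m z := Finset.sum_le_sum fun z hz =>
            Nat.one_le_iff_ne_zero.2 (by simpa [rowSupport] using hz)
        _ ≤ _ := Finset.sum_le_sum_of_subset (Finset.subset_univ _)
    have hpos : 1 ≤ (rowSupport m).card := by
      by_contra hcon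
      have h0 : rowSupport m = ∅ := Finset.card_eq_zero.1 (by omega)
      refine hm (Finset.sum_eq_zero fun z _ => ?_)
      by_contra hz
      have : z ∈ rowSupport m := by simpa [rowSupport] using hz
      simp [h0] at this
    refine (abs_integral_prod_centredRow_le (p x) h.v_nonneg x (h.loopless x) m h.one_le ha h.v_le
      (hexp x _ (hcard.trans hmt))).trans ?_
    set M := ∑ z, m z with hM
    obtain ⟨k, hk⟩ : ∃ k, (rowSupport m).card = k + 1 := ⟨_, (Nat.sub_add_cancel hpos).symm⟩
    obtain ⟨j, hj⟩ : ∃ j, M = j + 2 := ⟨M - 2, by omega⟩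
    have e1 : Λ * Λ⁻¹ ^ M ≤ μ ^ M := by
      have : Λ * Λ⁻¹ ^ M = μ ^ (M + j) := by
        rw [← hμ2, ← pow_mul, show 2 * M = (M + j) + 2 by omega, pow_add, hμ2]
        field_simp
      rw [this]
      exact pow_le_pow_of_le_one hμ0 hμ1 (by omega)
    have e2 : Λ⁻¹ ^ m x ≤ μ ^ m x := by
      refine pow_le_pow_left₀ (by positivity) ?_ _
      rw [← hμ2]; nlinarith
    have hβ := h.β_nonneg
    have e3 : Λ * (Λ⁻¹ ^ M + β * Λ⁻¹ ^ m x) ≤ 2 ^ M * max (μ ^ M) (β * Λ * μ ^ m x) := by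
      have h2 : (2 : ℝ) ≤ 2 ^ M := by
        calc (2 : ℝ) = 2 ^ 1 := by norm_num
          _ ≤ 2 ^ M := pow_le_pow_right₀ (by norm_num) (by omega)
      calc Λ * (Λ⁻¹ ^ M + β * Λ⁻¹ ^ m x) = Λ * Λ⁻¹ ^ M + β * Λ * Λ⁻¹ ^ m x := by ring
        _ ≤ μ ^ M + β * Λ * μ ^ m x := by gcongr
        _ ≤ 2 * max (μ ^ M) (β * Λ * μ ^ m x) := by
          have := le_max_left (μ ^ M) (β * Λ * μ ^ m x)
          have := le_max_right (μ ^ M) (β * Λ * μ ^ m x)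
          linarith
        _ ≤ _ := mul_le_mul_of_nonneg_right h2 (le_max_of_le_left (by positivity))
    rw [hk, Nat.add_sub_cancel]
    calc _ = 2 ^ M * (∏ z ∈ rowSupport m, stepWeight (fun y => (p x y : ℝ)) v Λ x z) * Λ ^ k *
          (Λ * (Λ⁻¹ ^ M + β * Λ⁻¹ ^ m x)) := by ring
      _ ≤ 2 ^ M * (∏ z ∈ rowSupport m, stepWeight (fun y => (p x y : ℝ)) v Λ x z) * Λ ^ k *
          (2 ^ M * max (μ ^ M) (β * Λ * μ ^ m x)) := by gcongr
      _ = _ := by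
        rw [show (4 : ℝ) = 2 * 2 by norm_num, mul_pow (2 : ℝ) 2]; ring

theorem abs_integral_walk_eq (el : List (V × V)) :
    |∫ G, (el.map fun e => centredMatrix v G e.1 e.2).prod ∂(matrixLaw p)| =
      ∏ u, |∫ g, ∏ z, centredRow v z g ^ el.count (u, z) ∂(rowLaw (p u))| := by
  simp_rw [prod_map_eq_prod_rows]
  rw [← Finset.abs_prod]
  congr 1
  exact integral_fintype_prod_eq_prod (f := fun u g => ∏ z, centredRow v z g ^ el.count (u, z))

theorem abs_integral_walk_le (h : Controlled p v t Λ β K Q ε) {s : ℕ} (x y : V)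
    {l l' : List V} (hl : l.length = s) (hl' : l'.length = s) (ψ : V → ℝ) (hψ0 : ∀ u, 0 ≤ ψ u)
    (hψ : ∀ u, ∑ z, (walkEdges x l ++ walkEdges y l').count (u, z) ≠ 0 →
      |∫ g, ∏ z, centredRow v z g ^ (walkEdges x l ++ walkEdges y l').count (u, z)
        ∂(rowLaw (p u))| ≤ 4 ^ (∑ z, (walkEdges x l ++ walkEdges y l').count (u, z)) *
      (∏ z ∈ rowSupport fun z => (walkEdges x l ++ walkEdges y l').count (u, z),
        stepWeight (fun y => (p u y : ℝ)) v Λ u z) *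
      Λ ^ ((rowSupport fun z => (walkEdges x l ++ walkEdges y l').count (u, z)).card - 1) * ψ u) :
    |∫ G, ((walkEdges x l ++ walkEdges y l').map fun e => centredMatrix v G e.1 e.2).prod
      ∂(matrixLaw p)| ≤
      16 ^ s * ((∏ e ∈ pairEdges x y l l', stepWeight (fun y => (p e.1 y : ℝ)) v Λ e.1 e.2) *
        Λ ^ excess x y l l') * ∏ u ∈ (pairEdges x y l l').image Prod.fst, ψ u := by
  have hlen : (walkEdges x l ++ walkEdges y l').length = 2 * s := by
    rw [List.length_append, length_walkEdges, length_walkEdges]; omega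
  rw [abs_integral_walk_eq]
  refine (prod_rows_le (walkEdges x l ++ walkEdges y l')
    (fun e => stepWeight (fun y => (p e.1 y : ℝ)) v Λ e.1 e.2) (Λ := Λ) _ ψ
    (fun u => abs_nonneg _) ?_ ?_).trans ?_
  · intro u hu
    have h0 : ∀ z, (walkEdges x l ++ walkEdges y l').count (u, z) = 0 := fun z =>
      List.count_eq_zero.2 fun hz => hu (Finset.mem_image.2 ⟨(u, z), List.mem_toFinset.2 hz, rfl⟩)
    simp [h0]
  · intro u hu
    refine hψ u fun h0 => ?_
    obtain ⟨⟨a, z⟩, he, rfl⟩ := Finset.mem_image.1 hu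
    have := Finset.sum_eq_zero_iff.1 h0 z (Finset.mem_univ z)
    exact (List.count_eq_zero.1 this) (List.mem_toFinset.1 he)
  · rw [hlen, pow_mul, show (4 : ℝ) ^ 2 = 16 by norm_num]
    refine mul_le_mul_of_nonneg_right ?_ (Finset.prod_nonneg fun u _ => hψ0 u)
    rw [mul_assoc]
    refine mul_le_mul_of_nonneg_left (mul_le_mul_of_nonneg_left ?_ ?_) (by positivity)
    · exact pow_le_pow_right₀ h.one_le (card_edges_sub_sources_le x y l l')
    · exact Finset.prod_nonneg fun e _ => h.weight_nonneg _ _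

theorem abs_integral_sum_pow_mul_pow_le (s : ℕ) (x y : V) {b : List V → List V → ℝ}
    (hb : ∀ l ∈ lists V s, ∀ l' ∈ lists V s,
      |∫ G, ((walkEdges x l ++ walkEdges y l').map fun e => centredMatrix v G e.1 e.2).prod
        ∂(matrixLaw p)| ≤ b l l') :
    |∫ G, ∑ z, (centredMatrix v G ^ s) x z * (centredMatrix v G ^ s) y z ∂(matrixLaw p)| ≤
      ∑ l ∈ lists V s, ∑ l' ∈ lists V s, b l l' := by
  simp_rw [sum_pow_mul_pow]
  rw [integral_finsetSum _ fun i _ => integrable_matrixLaw _ _]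
  refine (Finset.abs_sum_le_sum_abs _ _).trans (Finset.sum_le_sum fun l hl => ?_)
  rw [integral_finsetSum _ fun i _ => integrable_matrixLaw _ _]
  refine (Finset.abs_sum_le_sum_abs _ _).trans (Finset.sum_le_sum fun l' hl' => ?_)
  split_ifs
  · exact hb l hl l' hl'
  · simpa using (abs_nonneg _).trans (hb l hl l' hl')

/-- The decay comes from `prod_max_le` with `b = β * Λ` and `μ = √Λ⁻¹`, uniformly over pairs of
walks; `sum_walkPairs_le` counts the pairs. -/
theorem diag_le (h : Controlled p v t Λ β K Q ε) (hL : (2 * t + 2 : ℕ) * (Λ * Q) * 4 ^ t ≤ 1)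
    (x : V) :
    ∫ G, ∑ z, (centredMatrix v G ^ t) x z ^ 2 ∂(matrixLaw p) ≤
      16 ^ t * max ((β * Λ) ^ 2) (√Λ⁻¹ ^ (t - 1)) * ((K + 2) ^ (2 * t) * (Λ * 4 ^ t)) := by
  have hΛ : 0 < Λ := by linarith [h.one_le]
  have hμ1 : √Λ⁻¹ ≤ 1 := Real.sqrt_le_one.2 (inv_le_one_of_one_le₀ h.one_le)
  have hβ := h.β_nonneg
  have hmax : 0 ≤ max ((β * Λ) ^ 2) (√Λ⁻¹ ^ (t - 1)) := le_max_of_le_left (by positivity)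
  have key := abs_integral_sum_pow_mul_pow_le (v := v) (p := p) t x x
    (b := fun l l' => 16 ^ t * max ((β * Λ) ^ 2) (√Λ⁻¹ ^ (t - 1)) *
      ((∏ e ∈ pairEdges x x l l', stepWeight (fun y => (p e.1 y : ℝ)) v Λ e.1 e.2) *
        Λ ^ excess x x l l')) ?_
  · simp_rw [sq]
    rw [← sq (β * Λ)]
    refine (le_abs_self _).trans (key.trans ?_)
    simp_rw [← Finset.mul_sum]
    refine mul_le_mul_of_nonneg_left ?_ (by positivity)
    have := sum_walkPairs_le (fun e : V × V => stepWeight (fun y => (p e.1 y : ℝ)) v Λ e.1 e.2)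
      (fun e => h.weight_nonneg _ _) h.K_nonneg hΛ.le h.sum_le (fun e => h.weight_le _ _) t hL x x
    simpa using this
  · intro l hl l' hl'
    have hl := length_of_mem_lists hl
    have hl' := length_of_mem_lists hl'
    have hsum : ∑ u, ∑ z, (walkEdges x l ++ walkEdges x l').count (u, z) = 2 * t := by
      rw [sum_sum_count, List.length_append, length_walkEdges, length_walkEdges]; omega
    have hle : ∀ u, ∑ z, (walkEdges x l ++ walkEdges x l').count (u, z) ≤ 2 * t := fun u => by
      rw [← hsum]
      exact Finset.single_le_sum
        (f := fun u => ∑ z, (walkEdges x l ++ walkEdges x l').count (u, z))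
        (fun _ _ => Nat.zero_le _) (Finset.mem_univ u)
    refine (h.abs_integral_walk_le x x hl hl' _ (fun u => ?_)
      fun u hu => h.row_le u hu (hle u)).trans ?_
    · exact le_max_of_le_left (by positivity)
    · have hP : 0 ≤ ∏ e ∈ pairEdges x x l l', stepWeight (fun y => (p e.1 y : ℝ)) v Λ e.1 e.2 :=
        Finset.prod_nonneg fun e _ => h.weight_nonneg _ _
      have hprod := prod_max_le ((pairEdges x x l l').image Prod.fst)
        (fun u => ∑ z, (walkEdges x l ++ walkEdges x l').count (u, z))
        (fun u => (walkEdges x l ++ walkEdges x l').count (u, u)) t (Real.sqrt_nonneg Λ⁻¹) hμ1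
        (by positivity) h.β_le
        (fun u => Finset.single_le_sum
          (f := fun z => (walkEdges x l ++ walkEdges x l').count (u, z))
          (fun _ _ => Nat.zero_le _) (Finset.mem_univ u))
        (fun u => mult_le_loops_add x x u hl hl') (by
          rw [← hsum]
          refine Finset.sum_subset (Finset.subset_univ _) fun u _ hu => ?_
          refine Finset.sum_eq_zero fun z _ => List.count_eq_zero.2 fun hz => hu ?_
          exact Finset.mem_image.2 ⟨(u, z), List.mem_toFinset.2 hz, rfl⟩)
      refine (mul_le_mul_of_nonneg_left hprod (by positivity)).trans (le_of_eq (by ring))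

/-- Isolated starts give factors `ε ≤ σ⁻¹`. Charging `σ` to each unit of excess as well extracts
`σ⁻¹ ^ 2` from every pair by `two_le_excess_add`, and the pairs are then summed with `ρ = σ * Λ`. -/
theorem offDiag_le (h : Controlled p v t Λ β K Q ε) {σ : ℝ} (hσ : 1 ≤ σ) (hεσ : ε * σ ≤ 1)
    (hL : (2 * t + 2 : ℕ) * (σ * Λ * Q) * 4 ^ t ≤ 1) {s : ℕ} (hs : s ≤ t) {x y : V} (hxy : x ≠ y) :
    |∫ G, ∑ z, (centredMatrix v G ^ s) x z * (centredMatrix v G ^ s) y z ∂(matrixLaw p)| ≤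
      16 ^ s * (σ⁻¹) ^ 2 * (K + 2) ^ (2 * s) := by
  have hΛ : 0 < Λ := by linarith [h.one_le]
  have hσ0 : 0 < σ := by linarith
  have hμ1 : √Λ⁻¹ ≤ 1 := Real.sqrt_le_one.2 (inv_le_one_of_one_le₀ h.one_le)
  have hβ := h.β_nonneg
  have hK := h.K_nonneg
  have hε := h.ε_nonneg
  rcases Nat.eq_zero_or_pos s with rfl | hs0
  · have : ∀ z, (1 : Matrix V V ℝ) x z * (1 : Matrix V V ℝ) y z = 0 := by
      intro z
      by_cases hxz : x = z
      · rw [Matrix.one_apply_ne (hxz ▸ hxy.symm : y ≠ z), mul_zero]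
      · rw [Matrix.one_apply_ne hxz, zero_mul]
    simp only [pow_zero, this]
    simp
    positivity
  have key := abs_integral_sum_pow_mul_pow_le (v := v) (p := p) s x y
    (b := fun l l' => 16 ^ s * (σ⁻¹) ^ 2 *
      ((∏ e ∈ pairEdges x y l l', stepWeight (fun y => (p e.1 y : ℝ)) v Λ e.1 e.2) *
        (σ * Λ) ^ excess x y l l')) ?_
  · refine key.trans ?_
    simp_rw [← Finset.mul_sum]
    refine mul_le_mul_of_nonneg_left ?_ (by positivity)
    have hQ : 0 ≤ Q := (h.weight_nonneg x x).trans (h.weight_le x x)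
    have hL' : (2 * s + 2 : ℕ) * (σ * Λ * Q) * 4 ^ s ≤ 1 := by
      refine le_trans ?_ hL
      have : (4 : ℝ) ^ s ≤ 4 ^ t := pow_le_pow_right₀ (by norm_num) hs
      gcongr
    have := sum_walkPairs_le (fun e : V × V => stepWeight (fun y => (p e.1 y : ℝ)) v Λ e.1 e.2)
      (fun e => h.weight_nonneg _ _) h.K_nonneg (by positivity : 0 ≤ σ * Λ) h.sum_le
      (fun e => h.weight_le _ _) s hL' x y
    simpa [hxy] using this
  · intro l hl l' hl'
    have hl := length_of_mem_lists hl
    have hl' := length_of_mem_lists hl'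
    have hle : ∀ u, ∑ z, (walkEdges x l ++ walkEdges y l').count (u, z) ≤ 2 * t := fun u => by
      have hsum : ∑ u, ∑ z, (walkEdges x l ++ walkEdges y l').count (u, z) = 2 * s := by
        rw [sum_sum_count, List.length_append, length_walkEdges, length_walkEdges]; omega
      have := Finset.single_le_sum
        (f := fun u => ∑ z, (walkEdges x l ++ walkEdges y l').count (u, z))
        (fun _ _ => Nat.zero_le _) (Finset.mem_univ u)
      omega
    have hP : 0 ≤ ∏ e ∈ pairEdges x y l l', stepWeight (fun y => (p e.1 y : ℝ)) v Λ e.1 e.2 :=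
      Finset.prod_nonneg fun e _ => h.weight_nonneg _ _
    refine (h.abs_integral_walk_le x y hl hl'
      (fun u => if u ∈ isolatedStarts x y l l' then ε else 1) (fun u => ?_)
      fun u hu => ?_).trans ?_
    · split_ifs <;> positivity
    · split_ifs with hiso
      · obtain ⟨z, hzu, hz⟩ := count_isolatedStarts hxy
          (List.ne_nil_of_length_pos (by omega)) (List.ne_nil_of_length_pos (by omega)) hiso
        exact row_single_le u hz (h.mean_le u z hzu)
      · refine (h.row_le u hu (hle u)).trans (mul_le_mul_of_nonneg_left ?_ ?_)
        · exact max_le (pow_le_one₀ (Real.sqrt_nonneg _) hμ1)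
            (mul_le_one₀ h.β_le (by positivity) (pow_le_one₀ (Real.sqrt_nonneg _) hμ1))
        · have := Finset.prod_nonneg fun z (_ : z ∈ rowSupport fun z =>
            (walkEdges x l ++ walkEdges y l').count (u, z)) => h.weight_nonneg u z
          positivity
    · have hsub : isolatedStarts x y l l' ⊆ (pairEdges x y l l').image Prod.fst := by
        intro u hu
        obtain ⟨z, -, hz⟩ := count_isolatedStarts hxy
          (List.ne_nil_of_length_pos (by omega)) (List.ne_nil_of_length_pos (by omega)) hu
        refine Finset.mem_image.2 ⟨(u, z), ?_, rfl⟩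
        rw [pairEdges, List.mem_toFinset, ← List.count_pos_iff, hz]; simp
      have hprod : ∏ u ∈ (pairEdges x y l l').image Prod.fst,
          (if u ∈ isolatedStarts x y l l' then ε else 1) = ε ^ (isolatedStarts x y l l').card := by
        rw [← Finset.prod_filter, Finset.filter_mem_eq_inter, Finset.inter_eq_right.2 hsub,
          Finset.prod_const]
      rw [hprod]
      have hεσ' : ε ≤ σ⁻¹ := by rw [← one_div, le_div_iff₀ hσ0]; exact hεσ
      have h2 := two_le_excess_add x y l l'
      have h1 : Λ ^ excess x y l l' * ε ^ (isolatedStarts x y l l').card ≤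
          (σ⁻¹) ^ 2 * (σ * Λ) ^ excess x y l l' := by
        calc _ ≤ Λ ^ excess x y l l' * (σ⁻¹) ^ (isolatedStarts x y l l').card := by gcongr
          _ = (σ⁻¹) ^ (excess x y l l' + (isolatedStarts x y l l').card) *
              (σ * Λ) ^ excess x y l l' := by
            rw [pow_add, mul_pow, inv_pow, inv_pow]; field_simp
          _ ≤ _ := by
            refine mul_le_mul_of_nonneg_right ?_ (by positivity)
            exact pow_le_pow_of_le_one (by positivity) (inv_le_one_of_one_le₀ hσ) h2
      calc _ = 16 ^ s * (∏ e ∈ pairEdges x y l l',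
            stepWeight (fun y => (p e.1 y : ℝ)) v Λ e.1 e.2) *
            (Λ ^ excess x y l l' * ε ^ (isolatedStarts x y l l').card) := by ring
        _ ≤ 16 ^ s * (∏ e ∈ pairEdges x y l l',
            stepWeight (fun y => (p e.1 y : ℝ)) v Λ e.1 e.2) *
            ((σ⁻¹) ^ 2 * (σ * Λ) ^ excess x y l l') := by gcongr
        _ = _ := by ring

end Controlled

end Moments

/-! ### Deterministic expansion of the stationary distribution. -/

section Stationary

variable {V : Type*} [Fintype V] {v : V → ℝ}

theorem centredRow_add_nonneg (hv : ∀ z, 0 ≤ v z) (z : V) (g : V → Bool) :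
    0 ≤ centredRow v z g + v z := by
  have := hv z
  rw [centredRow]
  split_ifs
  · linarith
  · rw [sub_add_cancel]; positivity
  · linarith

theorem sum_centredRow (hv1 : ∑ z, v z = 1) (g : V → Bool) : ∑ z, centredRow v z g = 0 := by
  simp only [centredRow]
  split_ifs with h
  · simp
  · rw [Finset.sum_sub_distrib, hv1, ← Finset.sum_filter, Finset.sum_const, nsmul_eq_mul,
      mul_one_div, sub_eq_zero]
    exact div_self (by exact_mod_cast h)

variable [DecidableEq V]

theorem sum_centredMatrix_pow (hv1 : ∑ z, v z = 1) (G : V → V → Bool) (s : ℕ) (x : V) :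
    ∑ z, (centredMatrix v G ^ (s + 1)) x z = 0 := by
  simp_rw [pow_succ, Matrix.mul_apply]
  rw [Finset.sum_comm]
  refine Finset.sum_eq_zero fun u _ => ?_
  rw [← Finset.mul_sum]
  simp [centredMatrix, sum_centredRow hv1]

/-- Rows of positive powers sum to zero, so multiplying them by the centred matrix equals
multiplying by the stochastic matrix with rows `centredRow + v`, which does not increase the ℓ¹
norm. -/
theorem sum_abs_centredMatrix_pow_le (hv : ∀ z, 0 ≤ v z) (hv1 : ∑ z, v z = 1)
    (G : V → V → Bool) (s : ℕ) (x : V) : ∑ z, |(centredMatrix v G ^ s) x z| ≤ 2 := by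
  have hR : ∀ u, ∑ z, (centredRow v z (G u) + v z) = 1 := fun u => by
    rw [Finset.sum_add_distrib, sum_centredRow hv1, hv1, zero_add]
  rcases s with - | s
  · rw [pow_zero, Finset.sum_eq_single x (fun z _ hz => by simp [Matrix.one_apply_ne hz.symm])
      (by simp)]
    simp
  induction s with
  | zero =>
    calc ∑ z, |(centredMatrix v G ^ (0 + 1)) x z|
        ≤ ∑ z, ((centredRow v z (G x) + v z) + v z) := by
          refine Finset.sum_le_sum fun z _ => ?_
          have h1 := centredRow_add_nonneg hv z (G x)
          have h2 := hv z
          simp only [zero_add, pow_one, centredMatrix, Matrix.of_apply]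
          rw [abs_le]; constructor <;> linarith
      _ = 2 := by rw [Finset.sum_add_distrib, hR, hv1]; norm_num
  | succ s ih =>
    have h1 : ∀ z, (centredMatrix v G ^ (s + 1 + 1)) x z =
        ∑ u, (centredMatrix v G ^ (s + 1)) x u * (centredRow v z (G u) + v z) := by
      intro z
      simp_rw [mul_add]
      rw [Finset.sum_add_distrib, ← Finset.sum_mul, sum_centredMatrix_pow hv1, zero_mul, add_zero,
        pow_succ, Matrix.mul_apply]
      rfl
    calc ∑ z, |(centredMatrix v G ^ (s + 1 + 1)) x z|
        ≤ ∑ z, ∑ u, |(centredMatrix v G ^ (s + 1)) x u| * (centredRow v z (G u) + v z) := by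
          refine Finset.sum_le_sum fun z _ => ?_
          rw [h1]
          refine (Finset.abs_sum_le_sum_abs _ _).trans (Finset.sum_le_sum fun u _ => ?_)
          rw [abs_mul, abs_of_nonneg (centredRow_add_nonneg hv z (G u))]
      _ = ∑ u, |(centredMatrix v G ^ (s + 1)) x u| := by
          rw [Finset.sum_comm]
          simp_rw [← Finset.mul_sum, hR, mul_one]
      _ ≤ 2 := ih

theorem sum_sq_centredMatrix_pow_le (hv : ∀ z, 0 ≤ v z) (hv1 : ∑ z, v z = 1)
    (G : V → V → Bool) (s : ℕ) (x : V) :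
    ∑ z, (centredMatrix v G ^ s) x z * (centredMatrix v G ^ s) x z ≤ 4 := by
  have h := sum_abs_centredMatrix_pow_le hv hv1 G s x
  have h0 : 0 ≤ ∑ z, |(centredMatrix v G ^ s) x z| := Finset.sum_nonneg fun z _ => abs_nonneg _
  calc _ = ∑ z, |(centredMatrix v G ^ s) x z| ^ 2 := by simp [sq]
    _ ≤ (∑ z, |(centredMatrix v G ^ s) x z|) ^ 2 :=
      Finset.sum_sq_le_sq_sum_of_nonneg fun z _ => abs_nonneg _
    _ ≤ 4 := by nlinarith

theorem expand_of_vecMul_eq {N : Matrix V V ℝ} {π : V → ℝ} (h : π ᵥ* N = π - v) (t : ℕ) :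
    π = ∑ s ∈ Finset.range t, v ᵥ* N ^ s + π ᵥ* N ^ t := by
  induction t with
  | zero => simp
  | succ t ih =>
    rw [Finset.sum_range_succ, pow_succ', ← Matrix.vecMul_vecMul, h, Matrix.sub_vecMul]
    nth_rewrite 1 [ih]
    abel

theorem sum_sq_le_of_vecMul_eq {N : Matrix V V ℝ} {π : V → ℝ} (h : π ᵥ* N = π - v)
    (hπ : ∑ x, π x ^ 2 ≤ 1) (t : ℕ) :
    ∑ z, π z ^ 2 ≤ 2 * t * ∑ s ∈ Finset.range t, ∑ z, (v ᵥ* N ^ s) z ^ 2 +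
      2 * ∑ x, ∑ z, (N ^ t) x z ^ 2 := by
  have h1 : ∀ z, π z ^ 2 ≤ 2 * t * ∑ s ∈ Finset.range t, (v ᵥ* N ^ s) z ^ 2 +
      2 * ∑ x, (N ^ t) x z ^ 2 := by
    intro z
    have e : π z = ∑ s ∈ Finset.range t, (v ᵥ* N ^ s) z + (π ᵥ* N ^ t) z := by
      have := congrFun (expand_of_vecMul_eq h t) z
      rwa [Pi.add_apply, Finset.sum_apply] at this
    have e1 : (∑ s ∈ Finset.range t, (v ᵥ* N ^ s) z) ^ 2 ≤
        t * ∑ s ∈ Finset.range t, (v ᵥ* N ^ s) z ^ 2 := by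
      simpa using sq_sum_le_card_mul_sum_sq (s := Finset.range t) (f := fun s => (v ᵥ* N ^ s) z)
    have e2 : (π ᵥ* N ^ t) z ^ 2 ≤ ∑ x, (N ^ t) x z ^ 2 := by
      have := Finset.sum_mul_sq_le_sq_mul_sq Finset.univ π fun x => (N ^ t) x z
      refine this.trans (mul_le_of_le_one_left (Finset.sum_nonneg fun _ _ => sq_nonneg _) hπ)
    have e3 := add_sq_le (a := ∑ s ∈ Finset.range t, (v ᵥ* N ^ s) z) (b := (π ᵥ* N ^ t) z)
    rw [e]
    linarith
  refine (Finset.sum_le_sum fun z _ => h1 z).trans (le_of_eq ?_)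
  rw [Finset.sum_add_distrib, ← Finset.mul_sum, ← Finset.mul_sum, Finset.sum_comm]
  congr 2
  exact Finset.sum_comm

end Stationary

/-! ### From moment bounds to the expected squared norm of π. -/

theorem IsStationary.sum_sq_le_one {n : ℕ} {G : Graph n} {π : Fin n → ℝ} (h : IsStationary G π) :
    ∑ x, π x ^ 2 ≤ 1 := by
  obtain ⟨⟨h0, h1⟩, -⟩ := h
  calc ∑ x, π x ^ 2 ≤ (∑ x, π x) ^ 2 := Finset.sum_sq_le_sq_sum_of_nonneg fun x _ => h0 x
    _ = 1 := by rw [h1, one_pow]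

theorem sum_transition {n : ℕ} (G : Graph n) (x : Fin n) :
    ∑ z, transition G x z = if successes (G x) = 0 then 0 else 1 := by
  simp only [transition, Matrix.of_apply]
  rw [← Finset.sum_filter, Finset.sum_const, nsmul_eq_mul, mul_one_div]
  change (successes (G x) : ℝ) / (successes (G x) : ℝ) = _
  split_ifs with h
  · simp [h]
  · exact div_self (by exact_mod_cast h)

theorem IsStationary.vecMul_centredMatrix {n : ℕ} {G : Graph n} {π : Fin n → ℝ}
    (h : IsStationary G π) (v : Fin n → ℝ) : π ᵥ* centredMatrix v G = π - v := by
  obtain ⟨⟨h0, h1⟩, h2⟩ := h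
  have hN : ∀ x z, centredMatrix v G x z =
      transition G x z - (if successes (G x) = 0 then 0 else 1) * v z := by
    intro x z
    simp only [centredMatrix, centredRow, transition, Matrix.of_apply]
    change _ = (if G x z = true then 1 / (successes (G x) : ℝ) else 0) - _
    by_cases hs : successes (G x) = 0
    · have : ¬ G x z = true := fun hz => (successes_pos hz).ne' hs
      simp [hs, this]
    · simp [hs]
  -- A vertex without out-neighbours would lose its mass in one step, so stationarity gives it none.
  have hmass : ∑ x, π x * (if successes (G x) = 0 then (0 : ℝ) else 1) = 1 := by
    refine Eq.trans ?_ h1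
    conv_rhs => rw [← h2]
    simp only [Matrix.vecMul, dotProduct]
    rw [Finset.sum_comm]
    simp_rw [← Finset.mul_sum, sum_transition]
  funext z
  have h3 := congrFun h2 z
  simp only [Matrix.vecMul, dotProduct, Pi.sub_apply] at h3 ⊢
  simp_rw [hN, mul_sub, ← mul_assoc]
  rw [Finset.sum_sub_distrib, h3, ← Finset.sum_mul, hmass, one_mul]

theorem isStationary_stationary {n : ℕ} {G : Graph n} (h : G ∈ uniqueEvent n) :
    IsStationary G (stationary G) := by
  have h' : ∃! π : Fin n → ℝ, IsStationary G π := h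
  rw [stationary, dif_pos h']
  exact h'.choose_spec.1

theorem law_eq_matrixLaw {n : ℕ} (wOut wIn : Fin n → ℝ) :
    law wOut wIn = matrixLaw (edgeProb wOut wIn) := rfl

theorem setIntegral_sum_sq_stationary_le {n : ℕ} (p : Fin n → Fin n → unitInterval)
    {f : Graph n → ℝ} (hf0 : ∀ G, 0 ≤ f G)
    (hf : ∀ G ∈ uniqueEvent n, ∑ x, stationary G x ^ 2 ≤ f G) :
    ∫ G in uniqueEvent n, ∑ x, stationary G x ^ 2 ∂(matrixLaw p) ≤ ∫ G, f G ∂(matrixLaw p) := by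
  rw [← integral_indicator (Set.toFinite _).measurableSet]
  refine integral_mono (integrable_matrixLaw _ _) (integrable_matrixLaw _ _) fun G => ?_
  by_cases hG : G ∈ uniqueEvent n
  · rw [Set.indicator_of_mem hG]; exact hf G hG
  · rw [Set.indicator_of_notMem hG]; exact hf0 G

theorem setIntegral_sum_sq_stationary_le_one {n : ℕ} (p : Fin n → Fin n → unitInterval) :
    ∫ G in uniqueEvent n, ∑ x, stationary G x ^ 2 ∂(matrixLaw p) ≤ 1 := by
  refine (setIntegral_sum_sq_stationary_le p (f := fun _ => 1) (fun _ => zero_le_one)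
    fun G hG => (isStationary_stationary hG).sum_sq_le_one).trans (by simp)

/-- In the double sum for ‖vN^s‖², pairs x ≠ y use `offDiag_le`, and the diagonal uses the
deterministic bound 4, weighted by `v x ^ 2`. The Frobenius norm of N^t sums `diag_le` over the n
rows. -/
theorem Controlled.setIntegral_le {n : ℕ} {p : Fin n → Fin n → unitInterval} {v : Fin n → ℝ}
    {t : ℕ} {Λ β K Q ε σ : ℝ} (h : Controlled p v t Λ β K Q ε) (hv1 : ∑ z, v z = 1)
    (hσ : 1 ≤ σ) (hεσ : ε * σ ≤ 1) (hL : (2 * t + 2 : ℕ) * (σ * Λ * Q) * 4 ^ t ≤ 1) :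
    ∫ G in uniqueEvent n, ∑ x, stationary G x ^ 2 ∂(matrixLaw p) ≤
      2 * t * (t * (4 * ∑ x, v x ^ 2 + (4 * (K + 2)) ^ (2 * t) * (σ⁻¹) ^ 2)) +
      2 * (n * ((8 * (K + 2)) ^ (2 * t) * Λ * max ((β * Λ) ^ 2) (√Λ⁻¹ ^ (t - 1)))) := by
  have hv := h.v_nonneg
  have hΛ : 0 < Λ := by linarith [h.one_le]
  have hK := h.K_nonneg
  have hQ : Fin n → 0 ≤ Q := fun x => (h.weight_nonneg x x).trans (h.weight_le x x)
  have hoff : ∀ s ≤ t, ∀ x y, x ≠ y →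
      |∫ G, ∑ z, (centredMatrix v G ^ s) x z * (centredMatrix v G ^ s) y z ∂(matrixLaw p)| ≤
      (4 * (K + 2)) ^ (2 * t) * (σ⁻¹) ^ 2 := by
    intro s hs x y hxy
    refine (h.offDiag_le hσ hεσ hL hs hxy).trans ?_
    have e : (16 : ℝ) ^ s * σ⁻¹ ^ 2 * (K + 2) ^ (2 * s) = (4 * (K + 2)) ^ (2 * s) * σ⁻¹ ^ 2 := by
      rw [mul_pow, pow_mul (4 : ℝ)]; norm_num; ring
    rw [e]
    refine mul_le_mul_of_nonneg_right ?_ (by positivity)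
    exact pow_le_pow_right₀ (by linarith) (by omega)
  have hvN : ∀ s ≤ t, ∫ G, ∑ z, (v ᵥ* centredMatrix v G ^ s) z ^ 2 ∂(matrixLaw p) ≤
      4 * ∑ x, v x ^ 2 + (4 * (K + 2)) ^ (2 * t) * (σ⁻¹) ^ 2 := by
    intro s hs
    have e : ∀ G, ∑ z, (v ᵥ* centredMatrix v G ^ s) z ^ 2 = ∑ x, ∑ y, v x * v y *
        ∑ z, (centredMatrix v G ^ s) x z * (centredMatrix v G ^ s) y z := by
      intro G
      simp only [Matrix.vecMul, dotProduct, sq]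
      simp_rw [Finset.sum_mul_sum]
      rw [Finset.sum_comm]
      refine Finset.sum_congr rfl fun x _ => ?_
      rw [Finset.sum_comm]
      refine Finset.sum_congr rfl fun y _ => ?_
      rw [Finset.mul_sum]
      exact Finset.sum_congr rfl fun z _ => by ring
    simp_rw [e]
    rw [integral_finsetSum _ fun i _ => integrable_matrixLaw _ _]
    set B := (4 * (K + 2)) ^ (2 * t) * (σ⁻¹) ^ 2 with hB
    have hB0 : 0 ≤ B := by positivity
    calc _ = ∑ x, ∑ y, v x * v y * ∫ G, ∑ z, (centredMatrix v G ^ s) x z *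
          (centredMatrix v G ^ s) y z ∂(matrixLaw p) := by
          refine Finset.sum_congr rfl fun x _ => ?_
          rw [integral_finsetSum _ fun i _ => integrable_matrixLaw _ _]
          exact Finset.sum_congr rfl fun y _ => integral_const_mul _ _
      _ ≤ ∑ x, ∑ y, (v x * v y * B + if x = y then v x * v y * 4 else 0) := by
          refine Finset.sum_le_sum fun x _ => Finset.sum_le_sum fun y _ => ?_
          have hxy : 0 ≤ v x * v y := mul_nonneg (hv x) (hv y)
          split_ifs with hxy'
          · subst hxy'
            have : ∫ G, ∑ z, (centredMatrix v G ^ s) x z * (centredMatrix v G ^ s) x z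
                ∂(matrixLaw p) ≤ ∫ _, 4 ∂(matrixLaw p) :=
              integral_mono (integrable_matrixLaw _ _) (integrable_matrixLaw _ _)
                fun G => sum_sq_centredMatrix_pow_le hv hv1 G s x
            rw [integral_const] at this
            simp only [probReal_univ, one_smul] at this
            have := mul_le_mul_of_nonneg_left this hxy
            have := mul_nonneg hxy hB0
            linarith
          · rw [add_zero]
            exact mul_le_mul_of_nonneg_left ((le_abs_self _).trans (hoff s hs x y hxy')) hxy
      _ = 4 * ∑ x, v x ^ 2 + B := by
          simp_rw [Finset.sum_add_distrib, ← Finset.sum_mul, ← Finset.mul_sum, hv1]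
          simp only [Finset.sum_ite_eq, Finset.mem_univ, if_true, mul_one]
          rw [hv1, one_mul, Finset.mul_sum, add_comm]
          congr 1
          exact Finset.sum_congr rfl fun x _ => by ring
  have hdiag : ∀ x, ∫ G, ∑ z, (centredMatrix v G ^ t) x z ^ 2 ∂(matrixLaw p) ≤
      (8 * (K + 2)) ^ (2 * t) * Λ * max ((β * Λ) ^ 2) (√Λ⁻¹ ^ (t - 1)) := by
    intro x
    have hQ := hQ x
    have hL' : (2 * t + 2 : ℕ) * (Λ * Q) * 4 ^ t ≤ 1 := by
      refine le_trans ?_ hL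
      have : Λ * Q ≤ σ * Λ * Q := by
        rw [mul_assoc]; exact le_mul_of_one_le_left (by positivity) hσ
      gcongr
    refine (h.diag_le hL' x).trans (le_of_eq ?_)
    rw [mul_pow (8 : ℝ), show (8 : ℝ) ^ (2 * t) = 16 ^ t * 4 ^ t by rw [← mul_pow, pow_mul]; norm_num]
    ring
  have hf := setIntegral_sum_sq_stationary_le p (f := fun G =>
      2 * t * ∑ s ∈ Finset.range t, ∑ z, (v ᵥ* centredMatrix v G ^ s) z ^ 2 +
      2 * ∑ x, ∑ z, (centredMatrix v G ^ t) x z ^ 2) (fun G => by positivity) fun G hG =>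
    sum_sq_le_of_vecMul_eq ((isStationary_stationary hG).vecMul_centredMatrix v)
      (isStationary_stationary hG).sum_sq_le_one t
  refine hf.trans ?_
  rw [integral_add (integrable_matrixLaw _ _) (integrable_matrixLaw _ _), integral_const_mul,
    integral_const_mul, integral_finsetSum _ fun i _ => integrable_matrixLaw _ _,
    integral_finsetSum _ fun i _ => integrable_matrixLaw _ _]
  refine add_le_add (mul_le_mul_of_nonneg_left ?_ (by positivity))
    (mul_le_mul_of_nonneg_left ?_ (by positivity))
  · refine (Finset.sum_le_sum fun s hs => hvN s (Finset.mem_range.1 hs).le).trans (le_of_eq ?_)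
    rw [Finset.sum_const, Finset.card_range, nsmul_eq_mul]
  · refine (Finset.sum_le_sum fun x _ => hdiag x).trans (le_of_eq ?_)
    simp

/-! ### Chung–Lu probabilities satisfy the quantitative assumptions. -/

theorem edgeProb_self {n : ℕ} (wOut wIn : Fin n → ℝ) (x : Fin n) : edgeProb wOut wIn x x = 0 := by
  simp [edgeProb]

theorem coe_edgeProb_of_ne {n : ℕ} {wOut wIn : Fin n → ℝ} {x y : Fin n} (hxy : x ≠ y)
    (h0 : 0 ≤ wOut x * wIn y * (Real.log n / n)) (h1 : wOut x * wIn y * (Real.log n / n) ≤ 1) :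
    (edgeProb wOut wIn x y : ℝ) = wOut x * wIn y * (Real.log n / n) := by
  simp [edgeProb, hxy, h0, h1]

/-- In the Chernoff exponent `a * δ = κ`, while `(1 - exp (-a)) * M₀` is at least 1 + 4κ − 2κ; the
difference leaves the rate 1 + κ. -/
theorem controlled_edgeProb {M₀ M₁ κ a δ ω : ℝ} {n t : ℕ} {wOut wIn : Fin n → ℝ}
    (hM₀ : M₀ = 1 + 4 * κ) (hκ : 0 < κ) (ha : 0 < a) (haM : Real.exp (-a) * M₀ ≤ 2 * κ)
    (hδ : δ = κ / a) (hn : 2 ≤ n)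
    (hIn : ∀ x, 0 < wIn x) (hsum : ∑ x, wOut x = ∑ x, wIn x)
    (hw : ∀ x, M₀ ≤ wOut x ∧ wOut x ≤ M₁) (hω : ∀ x, wIn x ≤ ω)
    (h1 : (2 * t + 1) * (ω / n) ≤ M₀ - 1) (h2 : M₁ * Real.log n * (ω / n) ≤ 1 / 4)
    (h3 : ω / n ≤ 1 / 4) (h4 : 1 ≤ δ * Real.log n) (h5 : ω / n ≤ (δ * Real.log n)⁻¹)
    (h6 : Real.exp (-(1 + κ) * Real.log n) * (δ * Real.log n) ≤ 1)
    (h7 : ω / n * (2 + 2 * M₁ * Real.log n) + 1 / n ≤ (δ * Real.log n)⁻¹) :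
    Controlled (edgeProb wOut wIn) (fun z => wIn z / ∑ x, wIn x) t (δ * Real.log n)
      (Real.exp (-(1 + κ) * Real.log n)) (M₁ * (M₁ / δ + 1))
      (ω / n * (M₁ / δ + 1 + δ * Real.log n))
      (ω / n * (2 + 2 * M₁ * Real.log n) + 1 / n) := by
  have hδ0 : 0 < δ := by rw [hδ]; positivity
  have hn0 : (0 : ℝ) < n := by positivity
  have hl : 0 < Real.log n := Real.log_pos (by exact_mod_cast hn)
  set ℓ := Real.log n with hℓ
  set W := ∑ x, wIn x with hW
  have hOut : ∀ x, 0 < wOut x := fun x => by linarith [(hw x).1]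
  have hWlo : M₀ * n ≤ W := by
    rw [← hsum]
    have := Finset.card_nsmul_le_sum Finset.univ wOut M₀ fun x _ => (hw x).1
    simpa [mul_comm] using this
  have hWhi : W ≤ M₁ * n := by
    rw [← hsum]
    have := Finset.sum_le_card_nsmul Finset.univ wOut M₁ fun x _ => (hw x).2
    simpa [mul_comm] using this
  have hWn : (n : ℝ) ≤ W := by nlinarith
  have hW0 : 0 < W := by linarith
  have hM₁ : 0 < M₁ := by
    by_contra hcon
    nlinarith
  have x₀ : Fin n := ⟨0, by omega⟩
  have hω0 : 0 < ω := (hIn x₀).trans_le (hω x₀)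
  have hv : ∀ z, 0 ≤ wIn z / W := fun z => (div_pos (hIn z) hW0).le
  have hvω : ∀ z, wIn z / W ≤ ω / n := fun z => by
    have := hIn z
    have := hω z
    gcongr
  have hle : ∀ x y, wOut x * wIn y * (ℓ / n) ≤ M₁ * ℓ * (ω / n) := fun x y => by
    have := (hw x).2
    have := hω y
    have := (hIn y).le
    calc wOut x * wIn y * (ℓ / n) ≤ M₁ * ω * (ℓ / n) := by gcongr
      _ = _ := by ring
  have hp : ∀ x y, y ≠ x → (edgeProb wOut wIn x y : ℝ) = wOut x * wIn y * (ℓ / n) := by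
    intro x y hxy
    have := hOut x
    have := hIn y
    exact coe_edgeProb_of_ne hxy.symm (by positivity) (by linarith [hle x y])
  have hpx : ∀ x, (edgeProb wOut wIn x x : ℝ) = 0 := fun x => by simp [edgeProb_self]
  -- The total in-weight is at least `M₀ * n`, and by `h1` the at most `2 * t + 1` removed vertices
  -- carry at most `(M₀ - 1) * n`, so at least `n` remains.
  have hmean : ∀ (x : Fin n) (A : Finset (Fin n)), A.card ≤ 2 * t →
      M₀ * ℓ ≤ ∑ y ∈ Aᶜ, (edgeProb wOut wIn x y : ℝ) := by
    intro x A hA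
    have e1 : ∑ y ∈ (insert x A)ᶜ, (edgeProb wOut wIn x y : ℝ) ≤
        ∑ y ∈ Aᶜ, (edgeProb wOut wIn x y : ℝ) := by
      refine Finset.sum_le_sum_of_subset_of_nonneg
        (Finset.compl_subset_compl.2 (Finset.subset_insert _ _)) fun y _ _ => ?_
      exact (edgeProb wOut wIn x y).2.1
    have e2 : ∑ y ∈ (insert x A)ᶜ, (edgeProb wOut wIn x y : ℝ) =
        wOut x * (ℓ / n) * ∑ y ∈ (insert x A)ᶜ, wIn y := by
      rw [Finset.mul_sum]
      refine Finset.sum_congr rfl fun y hy => ?_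
      rw [hp x y (fun h => by simp [h] at hy)]; ring
    have e3 : ∑ y ∈ insert x A, wIn y ≤ (2 * t + 1) * ω := by
      refine (Finset.sum_le_card_nsmul _ _ ω fun y _ => hω y).trans ?_
      rw [nsmul_eq_mul]
      refine mul_le_mul_of_nonneg_right ?_ hω0.le
      have := (Finset.card_insert_le x A).trans (Nat.add_le_add_right hA 1)
      exact_mod_cast this
    have e4 := Finset.sum_add_sum_compl (insert x A) wIn
    have e5 : (2 * t + 1) * ω ≤ (M₀ - 1) * n := by
      rw [mul_div_assoc', div_le_iff₀ hn0] at h1; exact h1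
    have e6 : (n : ℝ) ≤ ∑ y ∈ (insert x A)ᶜ, wIn y := by linarith
    calc M₀ * ℓ = M₀ * (ℓ / n) * n := by field_simp
      _ ≤ wOut x * (ℓ / n) * ∑ y ∈ (insert x A)ᶜ, wIn y := by
        have := (hw x).1
        have := (hOut x).le
        gcongr
      _ ≤ _ := by rw [← e2]; exact e1
  have hsw : ∀ x z, z ≠ x → stepWeight (fun y => (edgeProb wOut wIn x y : ℝ))
      (fun z => wIn z / W) (δ * ℓ) x z ≤ (M₁ / δ + 1) * (wIn z / n) := by
    intro x z hz
    have := (hIn z).le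
    have e1 : wIn z / W ≤ wIn z / n := by gcongr
    have e2 : wOut x * wIn z * (ℓ / n) * (δ * ℓ)⁻¹ ≤ M₁ / δ * (wIn z / n) := by
      have : wOut x * wIn z * (ℓ / n) * (δ * ℓ)⁻¹ = wOut x / δ * (wIn z / n) := by
        field_simp
      rw [this]
      have := (hw x).2
      gcongr
    rw [stepWeight, if_neg hz, hp x z hz]
    linarith
  refine
    { v_nonneg := hv
      loopless := edgeProb_self _ _
      one_le := h4
      v_le := fun z => (hvω z).trans h5
      β_nonneg := (Real.exp_pos _).le
      β_le := h6
      exp_le := ⟨a, ha.le, fun x A hA => ?_⟩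
      K_nonneg := by positivity
      sum_le := fun x => ?_
      weight_le := fun x z => ?_
      ε_nonneg := by positivity
      ε_le := h7
      mean_le := fun x z hz => ?_ }
  · rw [Real.exp_le_exp]
    have e0 := hmean x A hA
    have e1 : Real.exp (-a) ≤ 1 := Real.exp_le_one_iff.2 (by linarith)
    have e2 : a * (δ * ℓ) = κ * ℓ := by rw [hδ]; field_simp
    have e3 : (1 - Real.exp (-a)) * (M₀ * ℓ) ≤
        (1 - Real.exp (-a)) * ∑ y ∈ Aᶜ, (edgeProb wOut wIn x y : ℝ) :=
      mul_le_mul_of_nonneg_left e0 (by linarith)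
    have e4 : Real.exp (-a) * M₀ * ℓ ≤ 2 * κ * ℓ := by gcongr
    rw [e2]
    rw [hM₀] at e3 e4
    linarith
  · calc _ ≤ ∑ z ∈ Finset.univ.erase x, (M₁ / δ + 1) * (wIn z / n) :=
          Finset.sum_le_sum fun z hz => hsw x z (Finset.ne_of_mem_erase hz)
      _ ≤ ∑ z, (M₁ / δ + 1) * (wIn z / n) := by
          refine Finset.sum_le_sum_of_subset_of_nonneg (Finset.subset_univ _) fun z _ _ => ?_
          have := hIn z
          positivity
      _ = (M₁ / δ + 1) * (W / n) := by rw [← Finset.mul_sum, Finset.sum_div]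
      _ ≤ (M₁ / δ + 1) * M₁ := by
          gcongr
          rw [div_le_iff₀ hn0]; exact hWhi
      _ = _ := mul_comm _ _
  · by_cases hz : z = x
    · rw [stepWeight, if_pos hz]
      have e1 := hvω x
      have e2 : 0 ≤ ω / n * (M₁ / δ + 1) := by positivity
      have e3 : wIn x / W * (δ * ℓ) ≤ ω / n * (δ * ℓ) := by gcongr
      linarith
    · refine (hsw x z hz).trans ?_
      have := hω z
      have e1 : (M₁ / δ + 1) * (wIn z / n) ≤ (M₁ / δ + 1) * (ω / n) := by gcongr
      have e2 : 0 ≤ ω / n * (δ * ℓ) := by positivity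
      linarith
  · have e0 := abs_integral_centredRow_le (edgeProb wOut wIn x) hv
      (by rw [← Finset.sum_div]; exact div_self hW0.ne') (edgeProb_self wOut wIn x)
      (κ := wOut x * ℓ / n * W) (P := M₁ * ℓ * (ω / n))
      (by have := hOut x; positivity)
      (fun y hy => by rw [hp x y hy]; field_simp) (fun y => ?_) h2 ((hvω x).trans h3) hz
    · refine e0.trans ?_
      have e1 : wIn z / W ≤ stepWeight (fun y => (edgeProb wOut wIn x y : ℝ))
          (fun z => wIn z / W) (δ * ℓ) x z := by
        rw [stepWeight, if_neg hz]
        have : (0 : ℝ) ≤ edgeProb wOut wIn x z := (edgeProb wOut wIn x z).2.1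
        have : 0 ≤ (edgeProb wOut wIn x z : ℝ) * (δ * ℓ)⁻¹ := by positivity
        linarith
      have e2 : Real.exp (-∑ y, (edgeProb wOut wIn x y : ℝ)) ≤ 1 / n := by
        have := hmean x ∅ (by simp)
        rw [Finset.compl_empty] at this
        have e3 : (1 : ℝ) / n = Real.exp (-ℓ) := by
          rw [Real.exp_neg, hℓ, Real.exp_log hn0, one_div]
        rw [e3, Real.exp_le_exp]
        nlinarith
      have e4 := hvω x
      refine mul_le_mul e1 ?_ (by have := hv x; positivity) ((hv z).trans e1)
      linarith
    · by_cases hy : y = x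
      · rw [hy, hpx]; positivity
      · rw [hp x y hy]; exact hle x y

/-! ### Choice of parameters for large n. -/

theorem eventually_mul_pow_mul_exp_le (H : ℝ) (k : ℕ) {c : ℝ} (hc : 0 < c) :
    ∀ᶠ ℓ : ℝ in Filter.atTop, H * ℓ ^ k * Real.exp (-c * ℓ) ≤ 1 := by
  have h1 := (isLittleO_pow_exp_pos_mul_atTop k hc).bound (c := 1 / (|H| + 1)) (by positivity)
  filter_upwards [h1] with ℓ h1
  rw [Real.norm_eq_abs, Real.norm_of_nonneg (Real.exp_pos _).le] at h1
  have h2 : 0 < |H| + 1 := by positivity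
  rw [div_mul_eq_mul_div, one_mul, le_div_iff₀ h2] at h1
  calc H * ℓ ^ k * Real.exp (-c * ℓ) ≤ (|ℓ ^ k| * (|H| + 1)) * Real.exp (-c * ℓ) := by
        refine mul_le_mul_of_nonneg_right ?_ (Real.exp_pos _).le
        calc H * ℓ ^ k ≤ |H * ℓ ^ k| := le_abs_self _
          _ = |ℓ ^ k| * |H| := by rw [abs_mul, mul_comm]
          _ ≤ _ := by gcongr; linarith
    _ ≤ Real.exp (c * ℓ) * Real.exp (-c * ℓ) := by gcongr
    _ = 1 := by rw [← Real.exp_add]; simp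

set_option maxHeartbeats 1000000 in
/-- The choice of the walk length and of the error scale for large `ℓ = log n`. -/
theorem eventually_parameters {M₁ κ δ d A K m : ℝ} (hM₁ : 0 < M₁) (hκ : 0 < κ) (hδ : 0 < δ)
    (hd : 0 < d) (hd1 : d < 1 / 2) (hA : 0 < A) (hK : 0 ≤ K) (hm : 0 < m) :
    ∃ θ : ℝ, 0 < θ ∧ ∀ᶠ ℓ : ℝ in Filter.atTop, ∃ (t : ℕ) (σ : ℝ), t ≤ θ * ℓ ∧ 1 ≤ σ ∧
      ∀ g, g = A * Real.exp (-(1 / 2 + d) * ℓ) →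
      (2 * t + 1) * g ≤ m ∧ M₁ * ℓ * g ≤ 1 / 4 ∧ g ≤ 1 / 4 ∧ 1 ≤ δ * ℓ ∧ g ≤ (δ * ℓ)⁻¹ ∧
      Real.exp (-(1 + κ) * ℓ) * (δ * ℓ) ≤ 1 ∧
      g * (2 + 2 * M₁ * ℓ) + Real.exp (-ℓ) ≤ (δ * ℓ)⁻¹ ∧
      (g * (2 + 2 * M₁ * ℓ) + Real.exp (-ℓ)) * σ ≤ 1 ∧
      (2 * t + 2 : ℕ) * (σ * (δ * ℓ) * (g * (M₁ / δ + 1 + δ * ℓ))) * 4 ^ t ≤ 1 ∧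
      (4 * (K + 2)) ^ (2 * t) * (σ⁻¹) ^ 2 ≤ Real.exp (-ℓ) ∧
      Real.exp ℓ * ((8 * (K + 2)) ^ (2 * t) * (δ * ℓ) *
        max ((Real.exp (-(1 + κ) * ℓ) * (δ * ℓ)) ^ 2) (√(δ * ℓ)⁻¹ ^ (t - 1))) ≤
        Real.exp (-ℓ) := by
  set c := Real.log (8 * (K + 2)) with hc
  have hK8 : (1 : ℝ) < 8 * (K + 2) := by linarith
  have hc0 : 0 < c := Real.log_pos hK8
  set r := min κ d with hr
  have hr0 : 0 < r := lt_min hκ hd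
  -- Makes the counting factor `(8 * (K + 2)) ^ (2 * t)` at most `exp (r / 2 * ℓ)`, a power of n
  -- small compared with both gains, from κ and from d.
  set θ := r / (4 * c) with hθ
  have hθ0 : 0 < θ := by positivity
  have hθc : θ * c = r / 4 := by rw [hθ]; field_simp
  -- Once `Λ ≥ exp (2 * B)`, each factor `√Λ⁻¹` is at most `exp (-B)`, so about `θ * ℓ` of them give
  -- n^{-(4+κ)}.
  set B := (4 + κ) / θ with hB
  have hBθ : B * θ = 4 + κ := by rw [hB]; field_simp
  have hB0 : 0 < B := by positivity
  refine ⟨θ, hθ0, ?_⟩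
  have hd2 : 0 < 1 / 2 + d := by positivity
  filter_upwards [Filter.eventually_ge_atTop (1 : ℝ), Filter.eventually_ge_atTop (1 / δ),
    Filter.eventually_ge_atTop (Real.exp (2 * B) / δ),
    eventually_mul_pow_mul_exp_le ((2 * θ + 1) * A / m) 1 hd2,
    eventually_mul_pow_mul_exp_le (4 * M₁ * A) 1 hd2,
    eventually_mul_pow_mul_exp_le (4 * A) 0 hd2,
    eventually_mul_pow_mul_exp_le (A * δ) 1 hd2,
    eventually_mul_pow_mul_exp_le δ 1 (by positivity : 0 < 1 + κ),
    eventually_mul_pow_mul_exp_le δ 1 (by positivity : 0 < 1 / 2 + d / 2),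
    eventually_mul_pow_mul_exp_le (2 * A * (2 + 2 * M₁)) 1 (by positivity : 0 < d / 2),
    eventually_mul_pow_mul_exp_le 2 0 (by linarith : 0 < 1 / 2 - d / 2),
    eventually_mul_pow_mul_exp_le ((2 * θ + 2) * δ * A * (M₁ / δ + 1 + δ)) 3
      (by positivity : 0 < d / 4),
    eventually_mul_pow_mul_exp_le (δ ^ 3) 3 (by positivity : 0 < 3 / 2 * κ),
    eventually_mul_pow_mul_exp_le (δ * Real.exp (2 * B)) 1 (by positivity : 0 < 2 + κ / 2)]
    with ℓ h1 hδℓ hBℓ q1 q2 q3 q4 q5 q6 q7 q8 q9 q10 q11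
  have hℓ : 0 < ℓ := by linarith
  have hΛ1 : 1 ≤ δ * ℓ := by rw [div_le_iff₀ hδ] at hδℓ; linarith
  have hΛ0 : 0 < δ * ℓ := by positivity
  have hΛB : Real.exp (2 * B) ≤ δ * ℓ := by rw [div_le_iff₀ hδ] at hBℓ; linarith
  set t := ⌊θ * ℓ⌋₊ with ht
  have htθ : (t : ℝ) ≤ θ * ℓ := Nat.floor_le (by positivity)
  have htθ' : θ * ℓ < t + 1 := Nat.lt_floor_add_one _
  -- Halfway between the scales 1/2 and 1/2 + d: `σ⁻¹ ^ 2` beats 1/n by a power of n, while `σ * g`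
  -- still decays.
  set σ := Real.exp ((1 / 2 + d / 2) * ℓ) with hσ
  have hσ1 : 1 ≤ σ := Real.one_le_exp (by positivity)
  refine ⟨t, σ, htθ, hσ1, ?_⟩
  rintro g rfl
  simp only [pow_one, pow_zero, mul_one] at q1 q2 q3 q4 q5 q6 q7 q8 q11
  set X := Real.exp (-(1 / 2 + d) * ℓ) with hX
  have hX0 : 0 < X := Real.exp_pos _
  have hpow : ∀ j : ℕ, (8 * (K + 2)) ^ j = Real.exp (c * j) := fun j => by
    rw [hc, mul_comm (Real.log _), Real.exp_nat_mul, Real.exp_log (by linarith)]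
  have hpow2 : (8 * (K + 2)) ^ (2 * t) ≤ Real.exp (r / 2 * ℓ) := by
    rw [hpow, Real.exp_le_exp]
    push_cast
    calc c * (2 * t) ≤ c * (2 * (θ * ℓ)) := by gcongr
      _ = 2 * (θ * c) * ℓ := by ring
      _ = r / 2 * ℓ := by rw [hθc]; ring
  have hpow4 : (4 : ℝ) ^ t ≤ Real.exp (d / 4 * ℓ) := by
    calc (4 : ℝ) ^ t ≤ (8 * (K + 2)) ^ t := pow_le_pow_left₀ (by norm_num) (by linarith) _
      _ = Real.exp (c * t) := hpow t
      _ ≤ Real.exp (d / 4 * ℓ) := by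
        rw [Real.exp_le_exp]
        calc c * t ≤ c * (θ * ℓ) := by gcongr
          _ = (θ * c) * ℓ := by ring
          _ ≤ d / 4 * ℓ := by
            rw [hθc]
            have : r ≤ d := min_le_right _ _
            gcongr
  have hσX : σ * X = Real.exp (-(d / 2) * ℓ) := by
    rw [hσ, hX, ← Real.exp_add]; congr 1; ring
  have hσΛ : σ⁻¹ ≤ (δ * ℓ)⁻¹ := by
    refine inv_anti₀ hΛ0 ?_
    have : Real.exp (-(1 / 2 + d / 2) * ℓ) = σ⁻¹ := by rw [hσ, ← Real.exp_neg]; congr 1; ring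
    rw [this, mul_inv_le_iff₀ (by positivity)] at q6
    linarith
  have c8 : (A * X * (2 + 2 * M₁ * ℓ) + Real.exp (-ℓ)) * σ ≤ 1 := by
    have e1 : A * X * (2 + 2 * M₁ * ℓ) * σ ≤ 1 / 2 := by
      calc A * X * (2 + 2 * M₁ * ℓ) * σ = A * (2 + 2 * M₁ * ℓ) * (σ * X) := by ring
        _ ≤ A * ((2 + 2 * M₁) * ℓ) * (σ * X) := by
          gcongr
          nlinarith
        _ = (2 * A * (2 + 2 * M₁) * ℓ * Real.exp (-(d / 2) * ℓ)) / 2 := by rw [hσX]; ring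
        _ ≤ 1 / 2 := by gcongr
    have e2 : Real.exp (-ℓ) * σ ≤ 1 / 2 := by
      have : Real.exp (-ℓ) * σ = Real.exp (-(1 / 2 - d / 2) * ℓ) := by
        rw [hσ, ← Real.exp_add]; congr 1; ring
      rw [this]; linarith
    linarith
  refine ⟨?_, ?_, ?_, hΛ1, ?_, ?_, ?_, c8, ?_, ?_, ?_⟩
  · have e1 : (2 * t + 1) * (A * X) ≤ (2 * θ + 1) * ℓ * (A * X) := by
      gcongr; nlinarith
    have e2 : (2 * θ + 1) * A / m * ℓ * X * m = (2 * θ + 1) * ℓ * (A * X) := by field_simp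
    have e3 := mul_le_mul_of_nonneg_right q1 hm.le
    linarith
  · linarith
  · linarith
  · rw [← one_div, le_div_iff₀ hΛ0]
    linarith
  · linarith
  · refine le_trans ?_ hσΛ
    rw [← one_div, le_div_iff₀ (by positivity)]
    exact c8
  · push_cast
    calc (2 * (t : ℝ) + 2) * (σ * (δ * ℓ) * (A * X * (M₁ / δ + 1 + δ * ℓ))) * 4 ^ t
        ≤ ((2 * θ + 2) * ℓ) * (σ * (δ * ℓ) * (A * X * ((M₁ / δ + 1 + δ) * ℓ))) *
          Real.exp (d / 4 * ℓ) := by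
          have e1 : 2 * (t : ℝ) + 2 ≤ (2 * θ + 2) * ℓ := by nlinarith
          have e2 : M₁ / δ + 1 + δ * ℓ ≤ (M₁ / δ + 1 + δ) * ℓ := by
            have : 0 ≤ M₁ / δ := by positivity
            nlinarith
          gcongr
      _ = (2 * θ + 2) * δ * A * (M₁ / δ + 1 + δ) * ℓ ^ 3 *
          ((σ * X) * Real.exp (d / 4 * ℓ)) := by ring
      _ = (2 * θ + 2) * δ * A * (M₁ / δ + 1 + δ) * ℓ ^ 3 * Real.exp (-(d / 4) * ℓ) := by
          rw [hσX, ← Real.exp_add]; congr 2; ring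
      _ ≤ 1 := q9
  · calc (4 * (K + 2)) ^ (2 * t) * (σ⁻¹) ^ 2 ≤ (8 * (K + 2)) ^ (2 * t) * (σ⁻¹) ^ 2 := by
          gcongr; norm_num
      _ ≤ Real.exp (r / 2 * ℓ) * (σ⁻¹) ^ 2 := by gcongr
      _ = Real.exp (r / 2 * ℓ - 2 * ((1 / 2 + d / 2) * ℓ)) := by
          rw [hσ, ← Real.exp_neg, ← Real.exp_nat_mul, ← Real.exp_add]; congr 1; push_cast; ring
      _ ≤ Real.exp (-ℓ) := by
          rw [Real.exp_le_exp]
          have : r ≤ d := min_le_right _ _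
          nlinarith
  · have hrκ : r ≤ κ := min_le_left _ _
    have e0 : Real.exp (r / 2 * ℓ) ≤ Real.exp (κ / 2 * ℓ) := by gcongr
    have key : ∀ Y, (δ * ℓ) * Y * Real.exp ((2 + κ / 2) * ℓ) ≤ 1 → 0 ≤ Y →
        Real.exp ℓ * ((8 * (K + 2)) ^ (2 * t) * (δ * ℓ) * Y) ≤ Real.exp (-ℓ) := by
      intro Y hY hY0
      calc Real.exp ℓ * ((8 * (K + 2)) ^ (2 * t) * (δ * ℓ) * Y)
          ≤ Real.exp ℓ * (Real.exp (κ / 2 * ℓ) * (δ * ℓ) * Y) := by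
            gcongr; exact hpow2.trans e0
        _ = (δ * ℓ) * Y * Real.exp ((2 + κ / 2) * ℓ) * Real.exp (-ℓ) := by
            rw [show (2 + κ / 2) * ℓ = ℓ + κ / 2 * ℓ + ℓ by ring, Real.exp_add, Real.exp_add,
              Real.exp_neg]
            field_simp
        _ ≤ 1 * Real.exp (-ℓ) := by gcongr
        _ = _ := one_mul _
    refine key _ ?_ (le_max_of_le_left (by positivity))
    rcases max_choice ((Real.exp (-(1 + κ) * ℓ) * (δ * ℓ)) ^ 2) (√(δ * ℓ)⁻¹ ^ (t - 1)) with
      hmax | hmax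
    · rw [hmax]
      refine le_trans (le_of_eq ?_) q10
      rw [mul_pow, ← Real.exp_nat_mul,
        show -(3 / 2 * κ) * ℓ = (2 : ℕ) * (-(1 + κ) * ℓ) + (2 + κ / 2) * ℓ by push_cast; ring,
        Real.exp_add]
      ring
    · rw [hmax]
      have e1 : √(δ * ℓ)⁻¹ ≤ Real.exp (-B) := by
        rw [Real.sqrt_le_left (Real.exp_pos _).le, ← Real.exp_nat_mul]
        refine (inv_anti₀ (Real.exp_pos _) hΛB).trans (le_of_eq ?_)
        rw [← Real.exp_neg]; congr 1; push_cast; ring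
      have e2 : √(δ * ℓ)⁻¹ ^ (t - 1) ≤ Real.exp (-(4 + κ) * ℓ + 2 * B) := by
        calc _ ≤ Real.exp (-B) ^ (t - 1) := pow_le_pow_left₀ (Real.sqrt_nonneg _) e1 _
          _ = Real.exp ((t - 1 : ℕ) * -B) := by rw [← Real.exp_nat_mul]
          _ ≤ _ := by
            rw [Real.exp_le_exp]
            have e3 : θ * ℓ - 2 ≤ ((t - 1 : ℕ) : ℝ) := by
              have : (t : ℝ) ≤ ((t - 1 : ℕ) : ℝ) + 1 := by exact_mod_cast (by omega)
              linarith
            have e4 := mul_le_mul_of_nonneg_left e3 hB0.le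
            have e5 : B * (θ * ℓ) = (4 + κ) * ℓ := by rw [← mul_assoc, hBθ]
            linarith
      calc δ * ℓ * √(δ * ℓ)⁻¹ ^ (t - 1) * Real.exp ((2 + κ / 2) * ℓ)
          ≤ δ * ℓ * Real.exp (-(4 + κ) * ℓ + 2 * B) * Real.exp ((2 + κ / 2) * ℓ) := by gcongr
        _ = δ * Real.exp (2 * B) * ℓ * Real.exp (-(2 + κ / 2) * ℓ) := by
          rw [show -(2 + κ / 2) * ℓ = -(4 + κ) * ℓ + (2 + κ / 2) * ℓ by ring, Real.exp_add,
            Real.exp_add]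
          ring
        _ ≤ 1 := q11

/-! ### Small cases, moments of the in-weights and conclusion. -/

/-- For n = 1 the target bound is 0 because log 1 = 0. A stationary distribution would need a loop,
which has probability zero. -/
theorem setIntegral_fin_one_le (wOut wIn : Fin 1 → ℝ) :
    ∫ G in uniqueEvent 1, ∑ x, stationary G x ^ 2 ∂(law wOut wIn) ≤ 0 := by
  rw [law_eq_matrixLaw]
  refine (setIntegral_sum_sq_stationary_le (edgeProb wOut wIn)
    (f := fun G => ∏ x, ∏ y, if G x y = true then 1 else 0) (fun G => ?_) fun G hG => ?_).trans ?_
  · exact Finset.prod_nonneg fun x _ => Finset.prod_nonneg fun y _ => by split_ifs <;> simp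
  · have hst := isStationary_stationary hG
    refine hst.sum_sq_le_one.trans ?_
    obtain ⟨⟨-, h1⟩, h2⟩ := hst
    have h3 := congrFun h2 0
    simp only [Matrix.vecMul, dotProduct, Fin.sum_univ_one] at h1 h3
    rw [h1, one_mul] at h3
    by_cases hG0 : G 0 0 = true
    · simp [hG0]
    · simp [transition, hG0] at h3
  · have hprod := integral_fintype_prod_eq_prod (𝕜 := ℝ)
      (μ := fun x => rowLaw (edgeProb wOut wIn x))
      (f := fun (_ : Fin 1) (g : Fin 1 → Bool) => ∏ y, if g y = true then (1 : ℝ) else 0)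
    refine le_of_eq (hprod.trans ?_)
    simp only [Fin.prod_univ_one]
    have := integral_rowLaw_prod (edgeProb wOut wIn 0) (fun _ b => if b = true then (1 : ℝ) else 0)
    simp only [Fin.prod_univ_one] at this
    rw [this, edgeProb_self]
    simp

theorem le_rpow_of_sum_rpow_le {n : ℕ} {w : Fin n → ℝ} (hw : ∀ x, 0 < w x) {q C : ℝ} (hq : 0 < q)
    (h : ∑ x, w x ^ q ≤ C) (x : Fin n) : w x ≤ C ^ (1 / q) := by
  have h1 : w x ^ q ≤ C := (Finset.single_le_sum (f := fun x => w x ^ q)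
    (fun y _ => Real.rpow_nonneg (hw y).le q) (Finset.mem_univ x)).trans h
  calc w x = (w x ^ q) ^ (1 / q) := by
        rw [← Real.rpow_mul (hw x).le, mul_one_div_cancel hq.ne', Real.rpow_one]
    _ ≤ _ := Real.rpow_le_rpow (Real.rpow_nonneg (hw x).le q) h1 (by positivity)

theorem sum_sq_le_of_sum_rpow_le {n : ℕ} {w : Fin n → ℝ} (hw : ∀ x, 0 < w x) {η C : ℝ}
    (hη : 0 < η) (h : ∑ x, w x ^ (2 + η) ≤ C) : ∑ x, w x ^ 2 ≤ n + C := by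
  calc ∑ x, w x ^ 2 ≤ ∑ x, (1 + w x ^ (2 + η)) := by
        refine Finset.sum_le_sum fun x _ => ?_
        have h0 := hw x
        have h1 := Real.rpow_nonneg h0.le (2 + η)
        rcases le_total (w x) 1 with hx | hx
        · nlinarith
        · have h2 := Real.rpow_le_rpow_of_exponent_le hx (by linarith : (2 : ℝ) ≤ 2 + η)
          rw [Real.rpow_two] at h2
          linarith
    _ ≤ _ := by rw [Finset.sum_add_distrib]; simpa using h

theorem eventually_setIntegral_le {M₀ M₁ M₂ η : ℝ} (hM₀ : 1 < M₀) (hM₁ : 1 < M₁) (hM₂ : 0 < M₂)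
    (hη₀ : 0 < η) :
    ∃ C : ℝ, 0 < C ∧ ∃ N : ℕ, ∀ n ≥ N, ∀ wOut wIn : Fin n → ℝ,
      (∀ x, 0 < wIn x) → ∑ x, wOut x = ∑ x, wIn x →
      (∀ x, M₀ ≤ wOut x ∧ wOut x ≤ M₁) → ∑ x, wIn x ^ (2 + η) ≤ M₂ * n →
      ∫ G in uniqueEvent n, ∑ x, stationary G x ^ 2 ∂(law wOut wIn)
        ≤ C * (Real.log n ^ 6 / n) := by
  set κ := (M₀ - 1) / 4 with hκ
  have hκ0 : 0 < κ := by rw [hκ]; linarith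
  have hMκ : M₀ = 1 + 4 * κ := by rw [hκ]; ring
  -- Since `a ≤ exp a`, this choice gives `exp (-a) * M₀ ≤ 2 * κ`.
  set a := M₀ / (2 * κ) with ha
  have ha0 : 0 < a := by positivity
  have haM : Real.exp (-a) * M₀ ≤ 2 * κ := by
    have h1 : M₀ = a * (2 * κ) := by rw [ha]; field_simp
    have h2 := Real.add_one_le_exp a
    rw [Real.exp_neg, inv_mul_le_iff₀ (Real.exp_pos _)]
    nlinarith
  set δ := κ / a with hδ
  have hδ0 : 0 < δ := by positivity
  set α := 1 / (2 + η) with hα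
  have hα0 : 0 < α := by positivity
  have hα1 : α < 1 / 2 := by
    rw [hα]; exact one_div_lt_one_div_of_lt (by norm_num) (by linarith)
  set A := M₂ ^ α with hA
  have hA0 : 0 < A := Real.rpow_pos_of_pos hM₂ _
  set K := M₁ * (M₁ / δ + 1) with hK
  have hK0 : 0 ≤ K := by positivity
  obtain ⟨θ, hθ, hev⟩ := eventually_parameters (M₁ := M₁) (κ := κ) (δ := δ) (d := 1 / 2 - α)
    (A := A) (K := K) (m := M₀ - 1) (by linarith) hκ0 hδ0 (by linarith) (by linarith) hA0 hK0
    (by linarith)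
  have hev' := (Real.tendsto_log_atTop.comp tendsto_natCast_atTop_atTop).eventually
    (hev.and (Filter.eventually_ge_atTop 1))
  obtain ⟨N, hN⟩ := Filter.eventually_atTop.1 (hev'.and (Filter.eventually_ge_atTop 2))
  refine ⟨2 * θ ^ 2 * (4 * (1 + M₂) + 1) + 2, by positivity, N,
    fun n hn wOut wIn hIn hsum hw hmom => ?_⟩
  obtain ⟨⟨⟨t, σ, htθ, hσ, hcond⟩, hℓ1⟩, hn2⟩ := hN n hn
  simp only [Function.comp_apply] at htθ hcond hℓ1
  have hn0 : (0 : ℝ) < n := by positivity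
  have hexp : Real.exp (Real.log n) = n := Real.exp_log hn0
  have hexp' : Real.exp (-Real.log n) = 1 / n := by rw [Real.exp_neg, hexp, one_div]
  set ω := (M₂ * n) ^ α with hω
  have hωn : ω / n = A * Real.exp (-(1 / 2 + (1 / 2 - α)) * Real.log n) := by
    rw [hω, Real.mul_rpow hM₂.le hn0.le, mul_div_assoc, Real.rpow_def_of_pos hn0]
    congr 1
    nth_rewrite 2 [← hexp]
    rw [← Real.exp_sub]
    congr 1; ring
  obtain ⟨c1, c2, c3, c4, c5, c6, c7, c8, c9, c10, c11⟩ := hcond _ hωn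
  rw [hexp'] at c7 c8 c10 c11
  rw [hexp] at c11
  have hctrl := controlled_edgeProb (t := t) hMκ hκ0 ha0 haM hδ hn2 hIn hsum hw
    (le_rpow_of_sum_rpow_le hIn (by linarith : 0 < 2 + η) hmom) c1 c2 c3 c4 c5 c6 c7
  have hWn : (n : ℝ) ≤ ∑ x, wIn x := by
    have := Finset.card_nsmul_le_sum Finset.univ wOut M₀ fun x _ => (hw x).1
    rw [hsum] at this
    simp only [Finset.card_univ, Fintype.card_fin, nsmul_eq_mul] at this
    nlinarith
  have hW0 : 0 < ∑ x, wIn x := by linarith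
  have hv2 : ∑ x, (wIn x / ∑ x, wIn x) ^ 2 ≤ (1 + M₂) / n := by
    simp_rw [div_pow]
    rw [← Finset.sum_div]
    calc (∑ x, wIn x ^ 2) / (∑ x, wIn x) ^ 2 ≤ (n + M₂ * n) / (n : ℝ) ^ 2 := by
          have := sum_sq_le_of_sum_rpow_le hIn hη₀ hmom
          gcongr
      _ = _ := by field_simp
  rw [law_eq_matrixLaw]
  refine (hctrl.setIntegral_le (by rw [← Finset.sum_div]; exact div_self hW0.ne') hσ c8 c9).trans ?_
  set ℓ := Real.log n with hℓ
  have hℓ2 : ℓ ^ 2 ≤ ℓ ^ 6 := pow_le_pow_right₀ hℓ1 (by norm_num)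
  have hℓ6 : 1 ≤ ℓ ^ 6 := one_le_pow₀ hℓ1
  have hB : 4 * ∑ x, (wIn x / ∑ x, wIn x) ^ 2 + (4 * (K + 2)) ^ (2 * t) * (σ⁻¹) ^ 2 ≤
      (4 * (1 + M₂) + 1) / n := by
    calc _ ≤ 4 * ((1 + M₂) / n) + 1 / n := by gcongr
      _ = _ := by ring
  have hB0 : 0 ≤ 4 * ∑ x, (wIn x / ∑ x, wIn x) ^ 2 + (4 * (K + 2)) ^ (2 * t) * (σ⁻¹) ^ 2 := by
    positivity
  calc _ ≤ 2 * (θ * ℓ) * ((θ * ℓ) * ((4 * (1 + M₂) + 1) / n)) + 2 * (1 / n) := by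
        gcongr
    _ = 2 * θ ^ 2 * (4 * (1 + M₂) + 1) * (ℓ ^ 2 / n) + 2 * (1 / n) := by ring
    _ ≤ 2 * θ ^ 2 * (4 * (1 + M₂) + 1) * (ℓ ^ 6 / n) + 2 * (ℓ ^ 6 / n) := by gcongr
    _ = _ := by ring

end ChungLu

end

theorem proposition5p7 (M₀ M₁ M₂ η : ℝ) (hM₀ : 1 < M₀) (hM₁ : 1 < M₁) (hM₂ : 0 < M₂)
    (hη₀ : 0 < η) (hη₁ : η < 1) :
    ∃ C₁ : ℝ, 0 < C₁ ∧ ∀ (n : ℕ) (wOut wIn : Fin n → ℝ),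
      (∀ x, 0 < wOut x) → (∀ x, 0 < wIn x) →
      ∑ x, wOut x = ∑ x, wIn x →
      (∀ x, M₀ ≤ wOut x ∧ wOut x ≤ M₁) →
      ∑ x, wIn x ^ (2 + η) ≤ M₂ * n →
      ∫ G in ChungLu.uniqueEvent n, ∑ x, ChungLu.stationary G x ^ 2 ∂(ChungLu.law wOut wIn)
        ≤ C₁ * (Real.log n ^ 6 / n) := by
  obtain ⟨C, hC, N, hN⟩ := ChungLu.eventually_setIntegral_le hM₀ hM₁ hM₂ hη₀
  have hlog2 : 0 < Real.log 2 := Real.log_pos (by norm_num)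
  -- The second summand handles 2 ≤ n < N, where the integral is at most 1 and log n ≥ log 2.
  refine ⟨C + N / Real.log 2 ^ 6, by positivity, fun n wOut wIn _ hIn hsum hw hmom => ?_⟩
  have hR : 0 ≤ Real.log n ^ 6 / n := by
    have : 0 ≤ Real.log n := Real.log_natCast_nonneg n
    positivity
  rw [add_mul]
  rcases le_or_gt N n with hn | hn
  · have := hN n hn wOut wIn hIn hsum hw hmom
    have : 0 ≤ (N : ℝ) / Real.log 2 ^ 6 * (Real.log n ^ 6 / n) := by positivity
    linarith
  · have hCR : 0 ≤ C * (Real.log n ^ 6 / n) := by positivity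
    rcases Nat.lt_or_ge n 2 with hn2 | hn2
    · interval_cases n
      · simp
      · refine (ChungLu.setIntegral_fin_one_le wOut wIn).trans ?_
        positivity
    · refine le_trans ?_ (le_add_of_nonneg_left hCR)
      rw [ChungLu.law_eq_matrixLaw]
      refine (ChungLu.setIntegral_sum_sq_stationary_le_one _).trans ?_
      have hn0 : (0 : ℝ) < n := by positivity
      have h1 : Real.log 2 ≤ Real.log n := Real.log_le_log (by norm_num) (by exact_mod_cast hn2)
      have h2 : Real.log 2 ^ 6 ≤ Real.log n ^ 6 := pow_le_pow_left₀ hlog2.le h1 6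
      have h3 : (n : ℝ) ≤ N := by exact_mod_cast hn.le
      rw [div_mul_div_comm, one_le_div (by positivity)]
      calc Real.log 2 ^ 6 * n ≤ Real.log n ^ 6 * N := by gcongr
        _ = _ := mul_comm _ _
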